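/- Let $n\ge N\ge 0$ be integers, let $a,b,c,d,z$ be elements of a field, and let $X_n=(x_1,\dots,x_n)$ be nonzero elements of it with $x_i\ne x_j$ and $x_i+x_j\neq0$ for $i\ne j$ (for instance, all of them independent indeterminates in a field of rational functions). *Notation.* $\operatorname{Pf}$ is the Pfaffian of a skew-symmetric matrix of even size, $O$ denotes zero matrices, and $J_m=(\delta_{i,m+1-j})_{1\le i,j\le m}$. Let $A_n=\left(\frac{x_i-x_j}{x_i+x_j}\right)_{1\le i,j\le n}$, where the diagonal entries are $0$. For a strict partition $\mu=(\mu_1>\dots>\mu_l>0)$ of length $\ell(\mu)=l$ let $\Gamma_\mu=(x_i^{\mu_j})_{1\le i\le n,\,1\le j\le l}$ and $$A_\mu(x_1,\dots,x_n)=\begin{pmatrix}A_n&\Gamma_\mu J_l\\-J_l\,{}^t\Gamma_\mu&O\end{pmatrix}.$$ Let $\operatorname{Pf}_\mu(x_1,\dots,x_n)$ be $\operatorname{Pf}A_\mu(x_1,\dots,x_n)$ if $n+l$ is even and $\operatorname{Pf}A_\mu(x_1,\dots,x_n,0)$ if $n+l$ is odd. Schur's $P$-function is $P_\mu(X_n)=\operatorname{Pf}_\mu(X_n)/\operatorname{Pf}_\emptyset(X_n)$.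 Put $$\omega(\mu)=a^{\sum_{i\ge1}\lceil\mu_{2i-1}/2\rceil}b^{\sum_{i\ge1}\lfloor\mu_{2i-1}/2\rfloor}c^{\sum_{i\ge1}\lceil\mu_{2i}/2\rceil}d^{\sum_{i\ge1}\lfloor\mu_{2i}/2\rfloor},\qquad \zeta_N(a,b,c,d;z;X_n)=\sum_{\mu}\omega(\mu)z^{\ell(\mu)}P_\mu(X_n),$$ where $\mu_i=0$ for $i>\ell(\mu)$ and the second sum runs over all strict partitions $\mu$ (including $\emptyset$) all of whose parts are at most $N$. Let $(\beta_{ij})_{i,j\ge-1}$ be the skew-symmetric array ($\beta_{ji}=-\beta_{ij}$, $\beta_{ii}=0$) with, for $-1\le i<j$, $$\beta_{ij}=\begin{cases}1&\text{if } i=-1,\ j=0,\\ a^{\lceil j/2\rceil}b^{\lfloor j/2\rfloor}z&\text{if } i=-1,\ j\ge1,\ \text{or } i=0,\\ a^{\lceil j/2\rceil}b^{\lfloor j/2\rfloor}c^{\lceil i/2\rceil}d^{\lfloor i/2\rfloor}z^2&\text{if } i>0.\end{cases}$$ Let $B_N=(\beta_{ij})_{0\le i,j\le N}$, $B_N'=(\beta_{ij})_{-1\le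 i,j\le N}$, $J'_{N+1}=\begin{pmatrix}O_{N+1,1}&J_{N+1}\end{pmatrix}$, and $\Gamma=(x_i^{N-j})_{1\le i\le n,\,0\le j\le N}$. *Claim.* $$\zeta_N(a,b,c,d;z;X_n)=\frac{\operatorname{Pf}(\mathcal C_{n,N})}{\operatorname{Pf}_\emptyset(X_n)}=\frac{\operatorname{Pf}(\mathcal D_{n,N})}{\operatorname{Pf}_\emptyset(X_n)},$$ where, if $n$ is even, $$\mathcal C_{n,N}=\begin{pmatrix}O&{}^t\Gamma J_n&J_{N+1}\\-J_n\Gamma&J_n\,{}^t\!A_nJ_n&O\\-J_{N+1}&O&B_N\end{pmatrix},\qquad \mathcal D_{n,N}=\left(\frac{x_i-x_j}{x_i+x_j}+\sum_{0\le k,l\le N}\beta_{kl}x_i^lx_j^k\right)_{1\le i,j\le n},$$ and, if $n$ is odd, $$\mathcal C_{n,N}=\begin{pmatrix}O&{}^t\Gamma J_n&J'_{N+1}\\-J_n\Gamma&J_n\,{}^t\!A_nJ_n&O\\-{}^tJ'_{N+1}&O&B'_N\end{pmatrix},\qquad \mathcal D_{n,N}=\begin{pmatrix}0&\left(\sum_{k=0}^N\beta_{-1,k}x_j^k\right)_{1\le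 j\le n}\\[2pt] \left(\sum_{k=0}^N\beta_{k,-1}x_i^k\right)_{1\le i\le n}&\left(\frac{x_i-x_j}{x_i+x_j}+\sum_{0\le k,l\le N}\beta_{kl}x_i^lx_j^k\right)_{1\le i,j\le n}\end{pmatrix}$$ (the second matrix with rows and columns numbered $0,1,\dots,n$). -/

import Mathlib

namespace SchurPSum

/-- The perfect matchings of `{0, …, k-1}` (`k` even), each written as the unique permutation
`σ` with `σ(2i) < σ(2i+1)` inside every block and the blocks listed by increasing first element. -/
def matchings (k : ℕ) : Finset (Equiv.Perm (Fin k)) :=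
  Finset.univ.filter fun σ =>
    (∀ i : Fin (k / 2), σ ⟨2 * i, by omega⟩ < σ ⟨2 * i + 1, by omega⟩) ∧
    (∀ i j : Fin (k / 2), i < j → σ ⟨2 * i, by omega⟩ < σ ⟨2 * j, by omega⟩)

/-- The Pfaffian of a skew-symmetric matrix of even size, as a signed sum over perfect matchings
(with value `0` in odd size, where it is never used). -/
def pf {R : Type*} [CommRing R] {k : ℕ} (A : Matrix (Fin k) (Fin k) R) : R :=
  if Even k then
    ∑ σ ∈ matchings k, ((Equiv.Perm.sign σ : ℤ) : R) *
      ∏ i : Fin (k / 2), A (σ ⟨2 * i, by omega⟩) (σ ⟨2 * i + 1, by omega⟩)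
  else 0

/-- A block matrix, with rows and columns numbered consecutively. -/
def blocks {R : Type*} {m n : ℕ} (A : Matrix (Fin m) (Fin m) R) (B : Matrix (Fin m) (Fin n) R)
    (C : Matrix (Fin n) (Fin m) R) (D : Matrix (Fin n) (Fin n) R) :
    Matrix (Fin (m + n)) (Fin (m + n)) R :=
  (Matrix.fromBlocks A B C D).reindex finSumFinEquiv finSumFinEquiv

/-- A `3 × 3` block matrix, with rows and columns numbered consecutively. -/
def blocks₃ {R : Type*} {m n p : ℕ}
    (A₁₁ : Matrix (Fin m) (Fin m) R) (A₁₂ : Matrix (Fin m) (Fin n) R) (A₁₃ : Matrix (Fin m) (Fin p) R)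
    (A₂₁ : Matrix (Fin n) (Fin m) R) (A₂₂ : Matrix (Fin n) (Fin n) R) (A₂₃ : Matrix (Fin n) (Fin p) R)
    (A₃₁ : Matrix (Fin p) (Fin m) R) (A₃₂ : Matrix (Fin p) (Fin n) R) (A₃₃ : Matrix (Fin p) (Fin p) R) :
    Matrix (Fin (m + n + p)) (Fin (m + n + p)) R :=
  (Matrix.fromBlocks (Matrix.fromBlocks A₁₁ A₁₂ A₂₁ A₂₂) (Matrix.fromRows A₁₃ A₂₃)
    (Matrix.fromCols A₃₁ A₃₂) A₃₃).reindex
      ((Equiv.sumCongr finSumFinEquiv (Equiv.refl _)).trans finSumFinEquiv)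
      ((Equiv.sumCongr finSumFinEquiv (Equiv.refl _)).trans finSumFinEquiv)

/-- The strict partitions all of whose parts are at most `N`, each as the strictly decreasing list
of its (positive) parts; see `mem_strictPartitions`. -/
def strictPartitions (N : ℕ) : Finset (List ℕ) :=
  (Finset.Icc 1 N).powerset.image fun S => S.sort (· ≥ ·)

theorem mem_strictPartitions {N : ℕ} {μ : List ℕ} :
    μ ∈ strictPartitions N ↔ μ.Pairwise (· > ·) ∧ ∀ p ∈ μ, 1 ≤ p ∧ p ≤ N := by
  unfold strictPartitions
  simp only [Finset.mem_image, Finset.mem_powerset]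
  constructor
  · rintro ⟨S, hS, rfl⟩
    refine ⟨(Finset.sortedGT_sort S).pairwise, fun p hp => ?_⟩
    simpa using hS (by simpa using hp)
  · rintro ⟨h1, h2⟩
    refine ⟨μ.toFinset, fun p hp => by simpa using h2 p (by simpa using hp), ?_⟩
    have hnd : μ.Nodup := h1.imp (fun h => ne_of_gt h)
    exact (List.toFinset_sort (· ≥ ·) hnd).2 (h1.imp fun h => le_of_lt h)

section Weight

variable {R : Type*} [CommRing R]

/-- The weight `ω(μ)`: rows of odd index (`μ₁, μ₃, …`, in positions `0, 2, …` of the list) are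
filled alternately with `a, b`, those of even index with `c, d`. -/
def weight (a b c d : R) (μ : List ℕ) : R :=
  a ^ (∑ i ∈ Finset.range μ.length, (μ.getD (2 * i) 0 + 1) / 2) *
  b ^ (∑ i ∈ Finset.range μ.length, μ.getD (2 * i) 0 / 2) *
  c ^ (∑ i ∈ Finset.range μ.length, (μ.getD (2 * i + 1) 0 + 1) / 2) *
  d ^ (∑ i ∈ Finset.range μ.length, μ.getD (2 * i + 1) 0 / 2)

/-- `β_{ij}` for `-1 ≤ i < j`. -/
def betaUpper (a b c d z : R) (i j : ℤ) : R :=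
  if i = -1 then
    if j = 0 then 1 else a ^ ((j.toNat + 1) / 2) * b ^ (j.toNat / 2) * z
  else if i = 0 then a ^ ((j.toNat + 1) / 2) * b ^ (j.toNat / 2) * z
  else a ^ ((j.toNat + 1) / 2) * b ^ (j.toNat / 2) *
    c ^ ((i.toNat + 1) / 2) * d ^ (i.toNat / 2) * z ^ 2

/-- The skew-symmetric array `(β_{ij})_{i,j ≥ -1}`. -/
def beta (a b c d z : R) (i j : ℤ) : R :=
  if i < j then betaUpper a b c d z i j
  else if j < i then -betaUpper a b c d z j i
  else 0

/-- `B_N = (β_{ij})_{0 ≤ i,j ≤ N}`. -/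
def matB (a b c d z : R) (N : ℕ) : Matrix (Fin (N + 1)) (Fin (N + 1)) R :=
  Matrix.of fun i j => beta a b c d z (i : ℕ) (j : ℕ)

/-- `B'_N = (β_{ij})_{-1 ≤ i,j ≤ N}`. -/
def matB' (a b c d z : R) (N : ℕ) : Matrix (Fin (N + 2)) (Fin (N + 2)) R :=
  Matrix.of fun i j => beta a b c d z (((i : ℕ) : ℤ) - 1) (((j : ℕ) : ℤ) - 1)

/-- The exchange matrix `J_n`, with ones on the antidiagonal. -/
def matJ (R : Type*) [CommRing R] (n : ℕ) : Matrix (Fin n) (Fin n) R :=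
  Matrix.of fun i j => if j = Fin.rev i then 1 else 0

/-- `J'_{N+1} = (O_{N+1,1}  J_{N+1})`. -/
def matJ' (R : Type*) [CommRing R] (N : ℕ) : Matrix (Fin (N + 1)) (Fin (N + 2)) R :=
  Matrix.of fun i => Fin.cons 0 (matJ R (N + 1) i)

/-- The `n × l` matrix `(x_i ^ {μ_j})`. -/
def matGamma {n l : ℕ} (x : Fin n → R) (μ : Fin l → ℕ) : Matrix (Fin n) (Fin l) R :=
  Matrix.of fun i j => x i ^ μ j

end Weight

section SchurP

variable {K : Type*} [Field K]

/-- `A_n = ((x_i - x_j) / (x_i + x_j))`. -/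
def matA {n : ℕ} (x : Fin n → K) : Matrix (Fin n) (Fin n) K :=
  Matrix.of fun i j => (x i - x j) / (x i + x j)

/-- `A_μ(x_1, …, x_n)`. -/
def matAmu {n : ℕ} (x : Fin n → K) (μ : List ℕ) :
    Matrix (Fin (n + μ.length)) (Fin (n + μ.length)) K :=
  blocks (matA x) (matGamma x μ.get * matJ K μ.length)
    (-(matJ K μ.length * (matGamma x μ.get).transpose)) 0

/-- `Pf_μ(x_1, …, x_n)`: the Pfaffian of `A_μ(x_1, …, x_n)` if `n + ℓ(μ)` is even, and of
`A_μ(x_1, …, x_n, 0)` if `n + ℓ(μ)` is odd. -/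
def pfMu {n : ℕ} (x : Fin n → K) (μ : List ℕ) : K :=
  if Even (n + μ.length) then pf (matAmu x μ)
  else pf (matAmu (Fin.snoc x 0 : Fin (n + 1) → K) μ)

/-- Schur's `P`-function `P_μ(x_1, …, x_n) = Pf_μ(x_1, …, x_n) / Pf_∅(x_1, …, x_n)`. -/
def schurP {n : ℕ} (x : Fin n → K) (μ : List ℕ) : K :=
  pfMu x μ / pfMu x []

/-- `ζ_N(a,b,c,d;z;X_n) = ∑ ω(μ) z^{ℓ(μ)} P_μ(X_n)` over strict `μ` with parts at most `N`. -/
def zetaN (a b c d z : K) {n : ℕ} (x : Fin n → K) (N : ℕ) : K :=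
  ∑ μ ∈ strictPartitions N, weight a b c d μ * z ^ μ.length * schurP x μ

/-- The sequence `μ^N = (N, …, 1, 0)`. -/
def muTop (N : ℕ) : Fin (N + 1) → ℕ := fun j => N - j

/-- The matrix `C_{n,N}` for `n` even. -/
def matCEven (a b c d z : K) {n : ℕ} (x : Fin n → K) (N : ℕ) :
    Matrix (Fin (N + 1 + n + (N + 1))) (Fin (N + 1 + n + (N + 1))) K :=
  blocks₃
    0 ((matGamma x (muTop N)).transpose * matJ K n) (matJ K (N + 1))
    (-(matJ K n * matGamma x (muTop N))) (matJ K n * (matA x).transpose * matJ K n) 0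
    (-(matJ K (N + 1))) 0 (matB a b c d z N)

/-- The matrix `C_{n,N}` for `n` odd. -/
def matCOdd (a b c d z : K) {n : ℕ} (x : Fin n → K) (N : ℕ) :
    Matrix (Fin (N + 1 + n + (N + 2))) (Fin (N + 1 + n + (N + 2))) K :=
  blocks₃
    0 ((matGamma x (muTop N)).transpose * matJ K n) (matJ' K N)
    (-(matJ K n * matGamma x (muTop N))) (matJ K n * (matA x).transpose * matJ K n) 0
    (-(matJ' K N).transpose) 0 (matB' a b c d z N)

/-- The matrix `D_{n,N}` for `n` even. -/
def matDEven (a b c d z : K) {n : ℕ} (x : Fin n → K) (N : ℕ) : Matrix (Fin n) (Fin n) K :=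
  Matrix.of fun i j => (x i - x j) / (x i + x j) +
    ∑ k ∈ Finset.range (N + 1), ∑ l ∈ Finset.range (N + 1),
      beta a b c d z k l * x i ^ l * x j ^ k

/-- The matrix `D_{n,N}` for `n` odd: the matrix given by the same entries as in the even case,
bordered by a row and a column of index `0`. -/
def matDOdd (a b c d z : K) {n : ℕ} (x : Fin n → K) (N : ℕ) :
    Matrix (Fin (1 + n)) (Fin (1 + n)) K :=
  blocks 0 (Matrix.of fun _ j => ∑ k ∈ Finset.range (N + 1), beta a b c d z (-1) k * x j ^ k)
    (Matrix.of fun i _ => ∑ k ∈ Finset.range (N + 1), beta a b c d z k (-1) * x i ^ k)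
    (matDEven a b c d z x N)

end SchurP

end SchurPSum

namespace SchurPSum

/-! ### Pfaffians: expansion along the first row -/

section PfaffianExpansion

/-! All three quantities have the same denominator, so only numerators matter. An alternating form
`S` defines a linear functional `wick S` on the exterior algebra whose value at a product of vectors
is the Pfaffian of their Gram matrix (`wick_ofFn_prod`). The sum of the Pfaffians `Pf_μ` thus
becomes one value of this functional, at the product of the vectors of the variables times a
generating element of strict partitions (`sum_pfMu_eq_wick`).

That generating element factors as an ordered product of even elements `1 + F_j θ_j e_j` with `θ_j =
u + ∑_{i<j} G_i e_i` (`partSum_eq_pairProd`). Here `F` and `G` are the row weights for `a, b` and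
for `c, d`: the sum over partitions becomes a product because the largest part sits in an odd or an
even row according to the parity of the length. Multiplying by `1 + pq` with `S p q = 0` only adds a
rank two form to `S` (`wick_one_add_pair_mul`), so the whole product changes `S` into a perturbed
form. Its Gram matrix on the variables is `D`, since `β_{kl} = G_k F_l` for `k < l`
(`sum_beta_mul`).

The parity rule in `Pf_μ` is carried by the extra vectors. The variable `0` is represented by `e_0`.
For even `n` one takes `u = 0`; for odd `n`, `u` is a new vector detected by a vector `star`, which
produces the bordering row.

For `C`, the variables are made orthogonal to the powers by subtracting dual vectors, which leaves
the exterior product unchanged. The powers and their duals then cancel (`wick_surround`), and the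
Pfaffian of `D` remains (`pf_matCEven`, `pf_matCOdd`). -/

theorem prod_univ_of_eq_succ {R : Type*} [CommMonoid R] {a b : ℕ} (h : a = b + 1) (f : Fin a → R) :
    ∏ i, f i = f ⟨0, by omega⟩ * ∏ i : Fin b, f ⟨i + 1, by omega⟩ := by
  subst h
  exact Fin.prod_univ_succ f

/-- The permutation sending `0 ↦ 0`, `1 ↦ p + 1`, and the remaining points to the remaining
points in the pattern given by `τ`. -/
def insertPair {k : ℕ} (p : Fin (k + 1)) (τ : Equiv.Perm (Fin k)) : Equiv.Perm (Fin (k + 2)) :=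
  Equiv.Perm.decomposeFin.symm
    (0, (p.cycleRange)⁻¹ * Equiv.Perm.decomposeFin.symm (0, τ))

theorem insertPair_zero {k : ℕ} (p : Fin (k + 1)) (τ : Equiv.Perm (Fin k)) :
    insertPair p τ 0 = 0 := by
  simp [insertPair]

theorem insertPair_one {k : ℕ} (p : Fin (k + 1)) (τ : Equiv.Perm (Fin k)) (h : 1 < k + 2) :
    insertPair p τ ⟨1, h⟩ = p.succ := by
  have : (⟨1, h⟩ : Fin (k + 2)) = Fin.succ 0 := rfl
  rw [this, insertPair, Equiv.Perm.decomposeFin_symm_apply_succ, Equiv.Perm.mul_apply,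
    Equiv.Perm.decomposeFin_symm_apply_zero, Equiv.swap_self, Equiv.refl_apply,
    Equiv.Perm.inv_def, Fin.cycleRange_symm_zero]

theorem insertPair_add_two {k : ℕ} (p : Fin (k + 1)) (τ : Equiv.Perm (Fin k)) (j : ℕ) (hj : j < k)
    (h : j + 2 < k + 2) :
    insertPair p τ ⟨j + 2, h⟩ = (p.succAbove (τ ⟨j, hj⟩)).succ := by
  have : (⟨j + 2, h⟩ : Fin (k + 2)) = Fin.succ (Fin.succ ⟨j, hj⟩) := rfl
  rw [this, insertPair, Equiv.Perm.decomposeFin_symm_apply_succ, Equiv.Perm.mul_apply,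
    Equiv.Perm.decomposeFin_symm_apply_succ, Equiv.swap_self, Equiv.refl_apply,
    Equiv.Perm.inv_def, Equiv.swap_self, Equiv.refl_apply, Fin.cycleRange_symm_succ]

theorem sign_insertPair {k : ℕ} (p : Fin (k + 1)) (τ : Equiv.Perm (Fin k)) :
    Equiv.Perm.sign (insertPair p τ) = (-1) ^ (p : ℕ) * Equiv.Perm.sign τ := by
  simp [insertPair, Equiv.Perm.decomposeFin.symm_sign, Fin.sign_cycleRange]

theorem exists_eq_decomposeFin_symm {k : ℕ} (σ : Equiv.Perm (Fin (k + 1))) (h : σ 0 = 0) :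
    ∃ ρ : Equiv.Perm (Fin k), σ = Equiv.Perm.decomposeFin.symm (0, ρ) := by
  refine ⟨(Equiv.Perm.decomposeFin σ).2, ?_⟩
  have h1 : (Equiv.Perm.decomposeFin σ).1 = 0 := by
    rw [← Equiv.Perm.decomposeFin_symm_apply_zero (Equiv.Perm.decomposeFin σ).1
      (Equiv.Perm.decomposeFin σ).2, Prod.mk.eta, Equiv.symm_apply_apply, h]
  rw [← h1, Prod.mk.eta, Equiv.symm_apply_apply]

theorem exists_eq_insertPair {k : ℕ} (σ : Equiv.Perm (Fin (k + 2))) (h : σ 0 = 0) :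
    ∃ p τ, σ = insertPair p τ := by
  obtain ⟨ρ, rfl⟩ := exists_eq_decomposeFin_symm σ h
  obtain ⟨τ, hτ⟩ := exists_eq_decomposeFin_symm ((ρ 0).cycleRange * ρ) (by simp)
  exact ⟨ρ 0, τ, by rw [insertPair, ← hτ, inv_mul_cancel_left]⟩

theorem insertPair_injective {k : ℕ} {p p' : Fin (k + 1)} {τ τ' : Equiv.Perm (Fin k)}
    (h : insertPair p τ = insertPair p' τ') : p = p' ∧ τ = τ' := by
  have hp : p = p' := by
    have := insertPair_one p τ (by omega)
    rw [h, insertPair_one] at this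
    exact (Fin.succ_injective _ this).symm
  subst hp
  refine ⟨rfl, ?_⟩
  simpa [insertPair] using h

theorem insertPair_mem_matchings {k : ℕ} (p : Fin (k + 1)) (τ : Equiv.Perm (Fin k)) :
    insertPair p τ ∈ matchings (k + 2) ↔ τ ∈ matchings k := by
  simp only [matchings, Finset.mem_filter, Finset.mem_univ, true_and]
  have key : ∀ (i j : ℕ) (hi : i < k) (hj : j < k),
      insertPair p τ ⟨i + 2, by omega⟩ < insertPair p τ ⟨j + 2, by omega⟩ ↔
        τ ⟨i, hi⟩ < τ ⟨j, hj⟩ := by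
    intro i j hi hj
    rw [insertPair_add_two p τ i hi, insertPair_add_two p τ j hj, Fin.succ_lt_succ_iff,
      Fin.succAbove_lt_succAbove_iff]
  constructor
  · rintro ⟨h1, h2⟩
    refine ⟨fun i => ?_, fun i j hij => ?_⟩
    · rw [← key]
      exact h1 ⟨i + 1, by omega⟩
    · rw [← key]
      exact h2 ⟨i + 1, by omega⟩ ⟨j + 1, by omega⟩ (by simpa using hij)
  · rintro ⟨h1, h2⟩
    refine ⟨?_, ?_⟩
    · rintro ⟨_ | i, hi⟩
      · have := insertPair_one p τ (by omega)
        simp only [Nat.mul_zero, Nat.zero_add, this]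
        exact (insertPair_zero p τ).symm ▸ Fin.succ_pos p
      · exact (key (2 * i) (2 * i + 1) (by omega) (by omega)).2 (h1 ⟨i, by omega⟩)
    · rintro ⟨i, hi⟩ ⟨_ | j, hj⟩ hij
      · simp at hij
      · rcases i with _ | i
        · have := insertPair_add_two p τ (2 * j) (by omega) (by omega)
          refine lt_of_eq_of_lt (insertPair_zero p τ) (lt_of_lt_of_eq (Fin.succ_pos _) this.symm)
        · exact (key (2 * i) (2 * j) (by omega) (by omega)).2
            (h2 ⟨i, by omega⟩ ⟨j, by omega⟩ (by simpa using hij))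

/-- The point `0` cannot be second in its block, nor lie in a later block than the first, because
something smaller would have to precede it. -/
theorem apply_zero_of_mem_matchings {k : ℕ} (hk : Even k) {σ : Equiv.Perm (Fin (k + 2))}
    (hσ : σ ∈ matchings (k + 2)) : σ 0 = 0 := by
  obtain ⟨m, rfl⟩ := hk
  simp only [matchings, Finset.mem_filter, Finset.mem_univ, true_and] at hσ
  obtain ⟨h1, h2⟩ := hσ
  obtain ⟨q, hq⟩ := σ.surjective 0
  rcases Nat.even_or_odd' (q : ℕ) with ⟨i, hi | hi⟩
  · have hq' : q = ⟨2 * i, by omega⟩ := Fin.ext hi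
    rcases Nat.eq_zero_or_pos i with rfl | hpos
    · rwa [hq'] at hq
    · have := h2 ⟨0, by omega⟩ ⟨i, by omega⟩ (by simpa using hpos)
      simp only [← hq', hq] at this
      exact absurd this (Fin.not_lt_zero _)
  · have hq' : q = ⟨2 * i + 1, by omega⟩ := Fin.ext hi
    have := h1 ⟨i, by omega⟩
    simp only [← hq', hq] at this
    exact absurd this (Fin.not_lt_zero _)

/-- Expansion of the Pfaffian along the first row. -/
theorem pf_add_two {R : Type*} [CommRing R] {k : ℕ} (A : Matrix (Fin (k + 2)) (Fin (k + 2)) R) :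
    pf A = ∑ p : Fin (k + 1), (-1) ^ (p : ℕ) * A 0 p.succ *
      pf (A.submatrix (fun j => (p.succAbove j).succ) fun j => (p.succAbove j).succ) := by
  by_cases hk : Even k
  · have hk2 : Even (k + 2) := by simpa [Nat.even_add] using hk
    simp only [pf, hk, hk2, if_true, Finset.mul_sum]
    rw [Finset.sum_sigma']
    symm
    refine Finset.sum_nbij (fun q => insertPair q.1 q.2) ?_ ?_ ?_ ?_
    · rintro ⟨p, τ⟩ h
      exact (insertPair_mem_matchings p τ).2 (by simpa using h)
    · rintro ⟨p, τ⟩ - ⟨p', τ'⟩ - h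
      obtain ⟨rfl, rfl⟩ := insertPair_injective h
      rfl
    · intro σ hσ
      obtain ⟨p, τ, rfl⟩ := exists_eq_insertPair σ (apply_zero_of_mem_matchings hk hσ)
      exact ⟨⟨p, τ⟩, by simpa using (insertPair_mem_matchings p τ).1 hσ, rfl⟩
    · rintro ⟨p, τ⟩ -
      have hd : (k + 2) / 2 = k / 2 + 1 := by omega
      rw [prod_univ_of_eq_succ hd, sign_insertPair]
      have h0 : insertPair p τ ⟨2 * 0, by omega⟩ = 0 := insertPair_zero p τ
      have h1 : insertPair p τ ⟨2 * 0 + 1, by omega⟩ = p.succ := insertPair_one p τ _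
      have h2 : ∀ i : Fin (k / 2), insertPair p τ ⟨2 * (i + 1), by omega⟩ =
        (p.succAbove (τ ⟨2 * i, by omega⟩)).succ := fun i => insertPair_add_two p τ _ _ _
      have h3 : ∀ i : Fin (k / 2), insertPair p τ ⟨2 * (i + 1) + 1, by omega⟩ =
        (p.succAbove (τ ⟨2 * i + 1, by omega⟩)).succ := fun i => insertPair_add_two p τ _ _ _
      simp only [h0, h1, h2, h3, Matrix.submatrix_apply]
      push_cast
      ring
  · have hk2 : ¬ Even (k + 2) := by simpa [Nat.even_add] using hk
    simp [pf, hk, hk2]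

theorem pf_zero {R : Type*} [CommRing R] (A : Matrix (Fin 0) (Fin 0) R) : pf A = 1 := by
  simp [pf, matchings]

theorem pf_one {R : Type*} [CommRing R] (A : Matrix (Fin 1) (Fin 1) R) : pf A = 0 := by
  simp [pf]

theorem pf_neg {R : Type*} [CommRing R] {k : ℕ} (A : Matrix (Fin k) (Fin k) R) :
    pf (-A) = (-1) ^ (k / 2) * pf A := by
  unfold pf
  split_ifs with h
  · rw [Finset.mul_sum]
    refine Finset.sum_congr rfl fun σ _ => ?_
    simp only [Matrix.neg_apply, Finset.prod_neg, Finset.card_univ, Fintype.card_fin]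
    ring
  · simp

end PfaffianExpansion

/-! ### The Pfaffian functional on the exterior algebra -/

section Wick

open CliffordAlgebra (contractLeft contractLeft_ι_mul changeForm)
open ExteriorAlgebra (ι)

variable {R V : Type*} [CommRing R] [AddCommGroup V] [Module R V]

theorem toQuadraticMap_neg_eq_sub {S : LinearMap.BilinForm R V} (hS : S.IsAlt) :
    (-S).toQuadraticMap = (0 : QuadraticForm R V) - 0 := by
  ext v
  simp [hS v]

/-- The linear form on the exterior algebra whose value at a product of vectors is the Pfaffian of
the matrix of their values under the alternating form `S`. -/
noncomputable def wick (S : LinearMap.BilinForm R V) (hS : S.IsAlt) : ExteriorAlgebra R V →ₗ[R] R :=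
  ExteriorAlgebra.algebraMapInv.toLinearMap ∘ₗ changeForm (toQuadraticMap_neg_eq_sub hS)

variable {S : LinearMap.BilinForm R V} (hS : S.IsAlt)

theorem wick_one : wick S hS 1 = 1 := by
  simp [wick]

/-- The change of form is taken along `-S`, so the contraction appears with a plus sign; the other
term, a left multiple of `v`, has no scalar part. -/
theorem wick_ι_mul (v : V) (y : ExteriorAlgebra R V) :
    wick S hS (ι R v * y) = wick S hS (contractLeft (S v) y) := by
  have h0 : ExteriorAlgebra.algebraMapInv (ι R v) = (0 : R) := by
    simp [ExteriorAlgebra.algebraMapInv]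
  rw [wick, LinearMap.comp_apply, LinearMap.comp_apply]
  erw [CliffordAlgebra.changeForm_ι_mul]
  rw [CliffordAlgebra.changeForm_contractLeft]
  simp [h0]

theorem ι_mul_ι_swap (v w : V) : ι R v * ι R w = -(ι R w * ι R v) :=
  eq_neg_of_add_eq_zero_left (ExteriorAlgebra.ι_add_mul_swap v w)

theorem commute_ι_mul_ι (p q : V) (y : ExteriorAlgebra R V) : Commute (ι R p * ι R q) y := by
  induction y using CliffordAlgebra.left_induction with
  | algebraMap r => exact (Algebra.commutes r _).symm
  | add x y hx hy => exact hx.add_right hy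
  | ι_mul x m hx =>
    refine Commute.mul_right ?_ hx
    change ι R p * ι R q * ι R m = ι R m * (ι R p * ι R q)
    rw [mul_assoc, ι_mul_ι_swap q m, mul_neg, ← mul_assoc, ι_mul_ι_swap p m, neg_mul, neg_neg,
      mul_assoc]

theorem wick_ι_mul_ι_mul (p q : V) (y : ExteriorAlgebra R V) :
    wick S hS (ι R p * ι R q * y) =
      S p q * wick S hS y - wick S hS (contractLeft (S q) (contractLeft (S p) y)) := by
  rw [mul_assoc, wick_ι_mul]
  erw [contractLeft_ι_mul]
  rw [map_sub, map_smul, smul_eq_mul]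
  congr 1
  exact wick_ι_mul hS _ _

/-- The rank two perturbation of `S` by the pair `p, q`. -/
def pairForm (S : LinearMap.BilinForm R V) (p q : V) : LinearMap.BilinForm R V :=
  (S q).smulRight (S p) - (S p).smulRight (S q)

theorem pairForm_apply (p q v w : V) : pairForm S p q v w = S q v * S p w - S p v * S q w := by
  simp [pairForm]

theorem pairForm_isAlt (p q : V) : (pairForm S p q).IsAlt := fun v => by
  rw [pairForm_apply]; ring

include hS in
theorem add_isAlt {T : LinearMap.BilinForm R V} (hT : T.IsAlt) : (S + T).IsAlt := fun v => by
  simp [hS v, hT v]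

/-- The change of form is an exponential of contractions. For a rank two form it stops after the
linear term, because contracting twice with the same functional gives zero. -/
theorem changeForm_pairForm (p q : V) (y : ExteriorAlgebra R V) :
    changeForm (toQuadraticMap_neg_eq_sub (pairForm_isAlt (S := S) p q)) y =
      y - contractLeft (S q) (contractLeft (S p) y) := by
  induction y using CliffordAlgebra.left_induction with
  | algebraMap r => simp
  | add x y hx hy => rw [map_add, hx, hy]; simp only [map_add]; abel
  | ι_mul x m hx =>
    rw [CliffordAlgebra.changeForm_ι_mul, hx, contractLeft_ι_mul]
    have : (-pairForm S p q) m = (S p m) • S q - (S q m) • S p := by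
      ext w; simp [pairForm]
    rw [this]
    simp only [map_sub, map_smul, LinearMap.sub_apply, LinearMap.smul_apply, contractLeft_ι_mul,
      CliffordAlgebra.contractLeft_contractLeft, mul_sub]
    rw [CliffordAlgebra.contractLeft_comm (S p) (S q) (contractLeft (S p) x),
      CliffordAlgebra.contractLeft_contractLeft]
    simp
    abel

theorem changeForm_congr {M : Type*} [AddCommGroup M] [Module R M] {Q Q' : QuadraticForm R M}
    {B B' : LinearMap.BilinForm R M} (h : B.toQuadraticMap = Q' - Q)
    (h' : B'.toQuadraticMap = Q' - Q) (hB : B = B') (y : CliffordAlgebra Q) :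
    changeForm h y = changeForm h' y := by
  subst hB; rfl

theorem wick_congr {S' : LinearMap.BilinForm R V} (hS' : S'.IsAlt) (h : S = S')
    (y : ExteriorAlgebra R V) : wick S hS y = wick S' hS' y := by
  subst h; rfl

/-- Removing `p` and `q` by contraction turns the factor into the operator of `changeForm_pairForm`,
and successive changes of form add up. -/
theorem wick_one_add_pair_mul {p q : V} (hpq : S p q = 0) (y : ExteriorAlgebra R V) :
    wick S hS ((1 + ι R p * ι R q) * y) =
      wick (S + pairForm S p q) (add_isAlt hS (pairForm_isAlt p q)) y := by
  rw [add_mul, one_mul, map_add, wick_ι_mul_ι_mul, hpq, zero_mul, zero_sub, ← sub_eq_add_neg,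
    ← map_sub, ← changeForm_pairForm]
  simp only [wick, LinearMap.comp_apply]
  rw [CliffordAlgebra.changeForm_changeForm]
  congr 1
  exact changeForm_congr _ _ (by abel) _

/-- Contraction is an antiderivation; the signs are those of the expansion of a Pfaffian along its
first row. -/
theorem contractLeft_ofFn_prod (d : Module.Dual R V) {k : ℕ} (v : Fin (k + 1) → V) :
    contractLeft d (List.ofFn fun i => ι R (v i)).prod =
      ∑ p : Fin (k + 1), ((-1) ^ (p : ℕ) * d (v p)) •
        (List.ofFn fun j => ι R (v (p.succAbove j))).prod := by
  induction k with
  | zero =>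
    simp only [List.ofFn_succ, List.ofFn_zero, List.prod_cons, List.prod_nil, mul_one]
    erw [CliffordAlgebra.contractLeft_ι]
    simp [Algebra.algebraMap_eq_smul_one]
  | succ k ih =>
    rw [List.ofFn_succ, List.prod_cons]
    erw [contractLeft_ι_mul]
    rw [ih (fun i => v i.succ), Fin.sum_univ_succ (n := k + 1), Finset.mul_sum, sub_eq_add_neg]
    congr 1
    · simp
    · rw [← Finset.sum_neg_distrib]
      refine Finset.sum_congr rfl fun p _ => ?_
      rw [List.ofFn_succ (n := k), List.prod_cons, Fin.succ_succAbove_zero, Fin.val_succ, pow_succ]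
      simp only [Fin.succ_succAbove_succ]
      rw [mul_neg_one, neg_mul, neg_smul]
      congr 1
      exact (mul_smul_comm _ _ _)

/-- Both sides obey the same recursion: contraction with the first vector on the left, expansion
along the first row on the right. -/
theorem wick_ofFn_prod {k : ℕ} (v : Fin k → V) :
    wick S hS (List.ofFn fun i => ι R (v i)).prod = pf (Matrix.of fun i j => S (v i) (v j)) := by
  induction k using Nat.twoStepInduction with
  | zero => simp [wick_one, pf_zero]
  | one =>
    rw [pf_one]
    simp only [List.ofFn_succ, List.ofFn_zero, List.prod_cons, List.prod_nil]
    rw [wick_ι_mul]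
    erw [CliffordAlgebra.contractLeft_one]
    simp
  | more k ih _ =>
    rw [List.ofFn_succ, List.prod_cons, wick_ι_mul, contractLeft_ofFn_prod, map_sum, pf_add_two]
    refine Finset.sum_congr rfl fun p _ => ?_
    rw [map_smul, ih, smul_eq_mul]
    rfl

end Wick

/-! ### Factorization of the generating element of strict partitions -/

section StrictPartitionSum

open ExteriorAlgebra (ι)

theorem strictPartitions_zero : strictPartitions 0 = {[]} := by
  simp [strictPartitions]

theorem sum_strictPartitions_succ {M : Type*} [AddCommMonoid M] (N : ℕ) (f : List ℕ → M) :
    ∑ μ ∈ strictPartitions (N + 1), f μ =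
      ∑ μ ∈ strictPartitions N, f μ + ∑ μ ∈ strictPartitions N, f ((N + 1) :: μ) := by
  have h : strictPartitions (N + 1) =
      strictPartitions N ∪ (strictPartitions N).image (List.cons (N + 1)) := by
    ext μ
    simp only [Finset.mem_union, Finset.mem_image, mem_strictPartitions]
    constructor
    · rintro ⟨h1, h2⟩
      rcases μ with _ | ⟨p, μ⟩
      · left; simp
      · rw [List.pairwise_cons] at h1
        have hp := h2 p (by simp)
        rcases Nat.lt_or_ge p (N + 1) with hlt | hge
        · left
          refine ⟨List.pairwise_cons.2 h1, fun q hq => ?_⟩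
          rcases List.mem_cons.1 hq with rfl | hq'
          · omega
          · have := h1.1 q hq'
            have := h2 q hq
            omega
        · right
          refine ⟨μ, ⟨h1.2, fun q hq => ?_⟩, by rw [show p = N + 1 by omega]⟩
          have := h1.1 q hq
          have := h2 q (List.mem_cons_of_mem _ hq)
          omega
    · rintro (⟨h1, h2⟩ | ⟨ν, ⟨h1, h2⟩, rfl⟩)
      · exact ⟨h1, fun q hq => by have := h2 q hq; omega⟩
      · refine ⟨List.pairwise_cons.2 ⟨fun q hq => ?_, h1⟩, fun q hq => ?_⟩
        · have := h2 q hq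
          omega
        · rcases List.mem_cons.1 hq with rfl | hq'
          · omega
          · have := h2 q hq'
            omega
  rw [h, Finset.sum_union, Finset.sum_image]
  · intro _ _ _ _ h
    exact (List.cons.inj h).2
  · rw [Finset.disjoint_left]
    intro μ hμ hμ'
    obtain ⟨ν, -, rfl⟩ := Finset.mem_image.1 hμ'
    have := (mem_strictPartitions.1 hμ).2 (N + 1) (by simp)
    omega

variable {R V : Type*} [CommRing R] [AddCommGroup V] [Module R V]

/-- A new first part pushes every other part down one row, which exchanges the roles of `a, b` and
`c, d`. -/
theorem weight_cons (a b c d : R) (p : ℕ) (μ : List ℕ) :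
    weight a b c d (p :: μ) = a ^ ((p + 1) / 2) * b ^ (p / 2) * weight c d a b μ := by
  -- The longer list adds one index to the range; there the default value `0` is read and
  -- contributes nothing.
  have hlen : μ.getD (2 * μ.length) 0 = 0 :=
    List.getD_eq_default _ _ (by omega)
  have hodd : ∀ f : ℕ → ℕ, ∑ i ∈ Finset.range (μ.length + 1), f ((p :: μ).getD (2 * i) 0) =
      ∑ i ∈ Finset.range μ.length, f (μ.getD (2 * i + 1) 0) + f p :=
    fun f => Finset.sum_range_succ' _ _
  have heven : ∀ f : ℕ → ℕ, f 0 = 0 →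
      ∑ i ∈ Finset.range (μ.length + 1), f ((p :: μ).getD (2 * i + 1) 0) =
        ∑ i ∈ Finset.range μ.length, f (μ.getD (2 * i) 0) := fun f hf => by
    change ∑ i ∈ Finset.range (μ.length + 1), f (μ.getD (2 * i) 0) = _
    rw [Finset.sum_range_succ, hlen, hf, add_zero]
  rw [weight, weight, List.length_cons, hodd fun m => (m + 1) / 2, hodd fun m => m / 2,
    heven (fun m => (m + 1) / 2) rfl, heven (fun m => m / 2) rfl, pow_add, pow_add]
  ring

/-- The factor contributed by a part `j` in a row filled alternately with `a, b`; a part `0`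
contributes `1`. -/
def rowWeight (a b z : R) (j : ℕ) : R :=
  if j = 0 then 1 else a ^ ((j + 1) / 2) * b ^ (j / 2) * z

/-- The generating element of strict partitions with parts at most `N`: each partition contributes
the product of the vectors `e` at its parts in increasing order, preceded by `p` or `q` according
to the parity of its length. -/
noncomputable def partSum (a b c d z : R) (e : ℕ → V) (p q : ExteriorAlgebra R V) (N : ℕ) :
    ExteriorAlgebra R V :=
  ∑ μ ∈ strictPartitions N, (weight a b c d μ * z ^ μ.length) •
    ((if Even μ.length then p else q) * (μ.reverse.map fun i => ι R (e i)).prod)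

theorem partSum_zero (a b c d z : R) (e : ℕ → V) (p q : ExteriorAlgebra R V) :
    partSum a b c d z e p q 0 = p := by
  simp [partSum, strictPartitions_zero, weight]

theorem partSum_succ (a b c d z : R) (e : ℕ → V) (p q : ExteriorAlgebra R V) (N : ℕ) :
    partSum a b c d z e p q (N + 1) = partSum a b c d z e p q N +
      rowWeight a b z (N + 1) • (partSum c d a b z e q p N * ι R (e (N + 1))) := by
  unfold partSum
  rw [sum_strictPartitions_succ, Finset.sum_mul, Finset.smul_sum]
  congr 1
  refine Finset.sum_congr rfl fun μ _ => ?_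
  have hif : (if Even (μ.length + 1) then p else q) = if Even μ.length then q else p := by
    by_cases h : Even μ.length <;> simp [Nat.even_add_one, h]
  rw [weight_cons, List.length_cons, hif, List.reverse_cons, List.map_append, List.prod_append,
    List.map_singleton, List.prod_singleton, smul_mul_assoc, smul_smul, mul_assoc, rowWeight,
    if_neg (Nat.succ_ne_zero N), pow_succ]
  congr 1
  · ring
  · rw [mul_assoc]

/-- The vector `u + ∑_{j < k} G_j e_j`. -/
def baseVec (u : V) (e : ℕ → V) (G : ℕ → R) (k : ℕ) : V :=
  u + ∑ j ∈ Finset.range k, G j • e j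

theorem baseVec_succ (u : V) (e : ℕ → V) (G : ℕ → R) (k : ℕ) :
    baseVec u e G (k + 1) = baseVec u e G k + G k • e k := by
  rw [baseVec, baseVec, Finset.sum_range_succ, add_assoc]

/-- The product of the factors `1 + F_j θ_j e_j` for `j < k`, where `θ_j = u + ∑_{i < j} G_i e_i`. -/
noncomputable def pairProd (u : V) (e : ℕ → V) (F G : ℕ → R) : ℕ → ExteriorAlgebra R V
  | 0 => 1
  | k + 1 => pairProd u e F G k * (1 + ι R (F k • baseVec u e G k) * ι R (e k))

theorem pairProd_succ (u : V) (e : ℕ → V) (F G : ℕ → R) (k : ℕ) :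
    pairProd u e F G (k + 1) =
      pairProd u e F G k + F k • (pairProd u e F G k * ι R (baseVec u e G k) * ι R (e k)) := by
  rw [pairProd, mul_add, mul_one, map_smul, smul_mul_assoc, mul_smul_comm, mul_assoc]

theorem ι_mul_self (v : V) : ι R v * ι R v = 0 := ExteriorAlgebra.ι_sq_zero v

/-- Each recursion step exchanges `a, b` with `c, d` and `p` with `q`, so both versions are carried
through the induction. The second is the first times the current `θ`. In the step, terms with a
repeated `θ` or a repeated `e (N + 1)` vanish. -/
theorem partSum_eq_pairProd (a b c d z : R) (u : V) (e : ℕ → V) (N : ℕ) :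
    partSum a b c d z e (1 + ι R u * ι R (e 0)) (ι R u + ι R (e 0)) N =
        pairProd u e (rowWeight a b z) (rowWeight c d z) (N + 1) ∧
      partSum c d a b z e (ι R u + ι R (e 0)) (1 + ι R u * ι R (e 0)) N =
        pairProd u e (rowWeight a b z) (rowWeight c d z) (N + 1) *
          ι R (baseVec u e (rowWeight c d z) (N + 1)) := by
  induction N with
  | zero =>
    -- A part `0` has weight `1`, so the first factor is `1 + u e_0` and the next `θ` is `u + e_0`:
    -- this dictates the choice of `p` and `q`.
    have h : ι R u * ι R (e 0) * ι R u = 0 := by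
      rw [ι_mul_ι_swap, neg_mul, mul_assoc, ι_mul_self, mul_zero, neg_zero]
    rw [partSum_zero, partSum_zero]
    simp only [pairProd, baseVec, rowWeight, Finset.range_zero, Finset.sum_empty, Finset.range_one,
      Finset.sum_singleton, if_true, one_smul, add_zero, zero_add, one_mul, true_and, map_add, add_mul,
      mul_add, h]
    rw [mul_assoc (ι R u) (ι R (e 0)) (ι R (e 0)), ι_mul_self, mul_zero, add_zero]
  | succ N ih =>
    rw [partSum_succ, partSum_succ, ih.1, ih.2]
    refine ⟨(pairProd_succ ..).symm, ?_⟩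
    rw [pairProd_succ _ _ _ _ (N + 1), baseVec_succ _ _ _ (N + 1)]
    generalize pairProd u e (rowWeight a b z) (rowWeight c d z) (N + 1) = P
    generalize baseVec u e (rowWeight c d z) (N + 1) = t
    generalize e (N + 1) = w
    have h : P * ι R t * ι R w * ι R t = 0 := by
      rw [mul_assoc P, mul_assoc P, ι_mul_ι_swap, neg_mul, mul_assoc, ι_mul_self, mul_zero,
        neg_zero, mul_zero]
    have h' : P * ι R t * ι R w * ι R w = 0 := by
      rw [mul_assoc, ι_mul_self, mul_zero]
    simp only [map_add, map_smul, mul_add, add_mul, smul_mul_assoc, mul_smul_comm, h, h', smul_zero,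
      add_zero]

variable (S : LinearMap.BilinForm R V) (u : V) (e : ℕ → V) (F G : ℕ → R)

/-- The form `S` perturbed by the pairs `F_j θ_j, e_j` for `j < k`. -/
noncomputable def pertForm : ℕ → LinearMap.BilinForm R V
  | 0 => S
  | k + 1 => pertForm k + pairForm S (F k • baseVec u e G k) (e k)

variable {S} in
theorem pertForm_isAlt (hS : S.IsAlt) (k : ℕ) : (pertForm S u e F G k).IsAlt := by
  induction k with
  | zero => exact hS
  | succ k ih => exact add_isAlt ih (pairForm_isAlt _ _)

theorem pertForm_apply (k : ℕ) (v w : V) :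
    pertForm S u e F G k v w = S v w + ∑ j ∈ Finset.range k, F j *
      (S (e j) v * S (baseVec u e G j) w - S (baseVec u e G j) v * S (e j) w) := by
  induction k with
  | zero => simp [pertForm]
  | succ k ih =>
    rw [pertForm, LinearMap.add_apply, LinearMap.add_apply, ih, Finset.sum_range_succ,
      pairForm_apply, map_smul, LinearMap.smul_apply, LinearMap.smul_apply, smul_eq_mul,
      smul_eq_mul]
    ring

theorem baseVec_left (k : ℕ) (w : V) :
    S (baseVec u e G k) w = S u w + ∑ j ∈ Finset.range k, G j * S (e j) w := by
  simp [baseVec]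

variable {S u e} in
-- The vectors `u` and `e_i` span an isotropic subspace. Hence no perturbation affects the values of
-- the form on these vectors, and the rank two terms simply accumulate.
theorem wick_mul_pairProd (hS : S.IsAlt) (he : ∀ i j, S (e i) (e j) = 0)
    (hu : ∀ i, S u (e i) = 0) (k : ℕ) (y : ExteriorAlgebra R V) :
    wick S hS (y * pairProd u e F G k) =
      wick (pertForm S u e F G k) (pertForm_isAlt u e F G hS k) y := by
  have hbe : ∀ k i, S (baseVec u e G k) (e i) = 0 := fun k i => by
    simp [baseVec_left, he, hu]
  have hbu : ∀ k, S (baseVec u e G k) u = 0 := fun k => by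
    rw [baseVec_left, hS u, zero_add]
    exact Finset.sum_eq_zero fun j _ => by rw [← hS.neg_eq, hu, neg_zero, mul_zero]
  have hbb : ∀ k l, S (baseVec u e G k) (baseVec u e G l) = 0 := fun k l => by
    conv_lhs => arg 2; rw [baseVec]
    simp [hbe, hbu]
  have heb : ∀ i l, S (e i) (baseVec u e G l) = 0 := fun i l => by
    rw [← hS.neg_eq, hbe, neg_zero]
  induction k generalizing y with
  | zero => simp [pairProd, pertForm]
  | succ k ih =>
    have hb : ∀ w, pertForm S u e F G k (baseVec u e G k) w = S (baseVec u e G k) w := fun w => by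
      simp [pertForm_apply, heb, hbb]
    have hek : ∀ w, pertForm S u e F G k (e k) w = S (e k) w := fun w => by
      simp [pertForm_apply, he, hbe]
    -- The last factor is even, hence central, and moves to the front, where it can be absorbed into
    -- the form already perturbed by the others.
    have hy : y * pairProd u e F G (k + 1) =
        (1 + ι R (F k • baseVec u e G k) * ι R (e k)) * y * pairProd u e F G k := by
      rw [pairProd, ← mul_assoc, mul_add, ← (commute_ι_mul_ι _ _ (y * pairProd u e F G k)).eq,
        mul_one, add_mul, one_mul, add_mul, mul_assoc (_ * _) y]
    rw [hy]
    rw [ih, wick_one_add_pair_mul _ (by rw [map_smul, LinearMap.smul_apply, hb, hbe, smul_zero])]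
    refine wick_congr _ _ ?_ _
    rw [pertForm]
    congr 1
    ext v w
    simp only [pairForm_apply, map_smul, LinearMap.smul_apply, hb, hek]

variable {S u e} in
theorem wick_mul_partSum (hS : S.IsAlt) (he : ∀ i j, S (e i) (e j) = 0)
    (hu : ∀ i, S u (e i) = 0) (a b c d z : R) (N : ℕ) (y : ExteriorAlgebra R V) :
    wick S hS (y * partSum a b c d z e (1 + ι R u * ι R (e 0)) (ι R u + ι R (e 0)) N) =
      wick (pertForm S u e (rowWeight a b z) (rowWeight c d z) (N + 1))
        (pertForm_isAlt u e _ _ hS _) y := by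
  rw [(partSum_eq_pairProd a b c d z u e N).1, wick_mul_pairProd _ _ hS he hu]

end StrictPartitionSum

/-! ### Products of vectors, and removal of an auxiliary vector -/

section WickPfaffian

open ExteriorAlgebra (ι)
open CliffordAlgebra (contractLeft)

variable {R V : Type*} [CommRing R] [AddCommGroup V] [Module R V]
variable {S : LinearMap.BilinForm R V}

theorem ofFn_prod_mul_ofFn_prod {m k : ℕ} (v : Fin m → V) (w : Fin k → V) :
    (List.ofFn fun i => ι R (v i)).prod * (List.ofFn fun i => ι R (w i)).prod =
      (List.ofFn fun i => ι R (Fin.append v w i)).prod := by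
  rw [← List.prod_append, ← List.ofFn_fin_append]
  congr 2
  funext i
  refine Fin.addCases (fun i => ?_) (fun i => ?_) i <;> simp

theorem ofFn_snoc_prod {m : ℕ} (v : Fin m → V) (w : V) :
    (List.ofFn fun i => ι R ((Fin.snoc v w : Fin (m + 1) → V) i)).prod =
      (List.ofFn fun i => ι R (v i)).prod * ι R w := by
  rw [List.ofFn_succ']
  simp

theorem map_reverse_eq_ofFn {α β : Type*} (l : List α) (f : α → β) :
    l.reverse.map f = List.ofFn fun j : Fin l.length => f (l.get j.rev) := by
  refine List.ext_getElem (by simp) fun i h1 h2 => ?_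
  simp only [List.getElem_map, List.getElem_reverse, List.getElem_ofFn, List.get_eq_getElem,
    Fin.val_rev]
  congr 2
  omega

theorem ofFn_prod_mul_ι {m : ℕ} (v : Fin m → V) (w : V) :
    (List.ofFn fun i => ι R (v i)).prod * ι R w =
      (-1) ^ m * (ι R w * (List.ofFn fun i => ι R (v i)).prod) := by
  induction m with
  | zero => simp
  | succ m ih =>
    rw [List.ofFn_succ, List.prod_cons, mul_assoc, ih, ← mul_assoc (ι R w), ι_mul_ι_swap w,
      neg_mul, pow_succ, mul_neg_one, neg_mul_neg, ← mul_assoc, ← mul_assoc, ← mul_assoc,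
      (Commute.neg_one_right (ι R (v 0))).pow_right m |>.eq, mul_assoc, mul_assoc]
    simp [mul_assoc]

theorem contractLeft_ι_mul_eq_zero {d : Module.Dual R V} {v : V} {y : ExteriorAlgebra R V}
    (hv : d v = 0) (hy : contractLeft d y = 0) : contractLeft d (ι R v * y) = 0 := by
  erw [CliffordAlgebra.contractLeft_ι_mul]
  rw [hv, hy, zero_smul, mul_zero, sub_zero]

theorem contractLeft_prod_mul_eq_zero {d : Module.Dual R V} (l : List V) {y : ExteriorAlgebra R V}
    (hl : ∀ v ∈ l, d v = 0) (hy : contractLeft d y = 0) :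
    contractLeft d ((l.map fun v => ι R v).prod * y) = 0 := by
  induction l with
  | nil => simpa using hy
  | cons v l ih =>
    rw [List.map_cons, List.prod_cons, mul_assoc]
    exact contractLeft_ι_mul_eq_zero (hl v (by simp)) (ih fun w hw => hl w (by simp [hw]))

theorem wick_ι_mul_ι_mul_of_contractLeft (hS : S.IsAlt) (p q : V) {y : ExteriorAlgebra R V}
    (hy : contractLeft (S p) y = 0) :
    wick S hS (ι R p * ι R q * y) = S p q * wick S hS y := by
  rw [wick_ι_mul_ι_mul, hy, map_zero, map_zero, sub_zero]

/-- A vector `s` pairing only with `u`, to `-1`, removes the vector `u` from a product. -/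
theorem wick_ι_mul_prod_mul (hS : S.IsAlt) {s u w : V} (hsu : S s u = -1) (hsw : S s w = 0) {n : ℕ}
    (hn : Odd n) (v : Fin n → V) (hsv : ∀ i, S s (v i) = 0) {y : ExteriorAlgebra R V}
    (hy : contractLeft (S s) y = 0) :
    wick S hS (ι R s * (List.ofFn fun i => ι R (v i)).prod * ((ι R u + ι R w) * y)) =
        wick S hS ((List.ofFn fun i => ι R (v i)).prod * y) ∧
      wick S hS (ι R s * (List.ofFn fun i => ι R (v i)).prod * ((1 + ι R u * ι R w) * y)) =
        wick S hS ((List.ofFn fun i => ι R (v i)).prod * ι R w * y) := by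
  have hX : ∀ {y : ExteriorAlgebra R V}, contractLeft (S s) y = 0 →
      contractLeft (S s) ((List.ofFn fun i => ι R (v i)).prod * y) = 0 := fun hy => by
    have := contractLeft_prod_mul_eq_zero (d := S s) (List.ofFn v)
      (fun v hv => by obtain ⟨i, rfl⟩ := (List.mem_ofFn' _ _).1 hv; exact hsv i) hy
    rwa [List.map_ofFn] at this
  -- As `n` is odd, crossing the product costs a sign, and this is why `s` pairs with `u` to `-1`.
  have hcomm : ∀ t, (List.ofFn fun i => ι R (v i)).prod * ι R t =
      -(ι R t * (List.ofFn fun i => ι R (v i)).prod) := fun t => by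
    rw [ofFn_prod_mul_ι, hn.neg_one_pow, neg_one_mul]
  constructor
  · rw [add_mul, mul_add, map_add, mul_assoc _ _ (ι R w * y), wick_ι_mul,
      hX (contractLeft_ι_mul_eq_zero hsw hy), map_zero, add_zero, mul_assoc,
      ← mul_assoc _ (ι R u), hcomm, neg_mul, mul_neg, map_neg, ← mul_assoc, ← mul_assoc, mul_assoc _ _ y,
      wick_ι_mul_ι_mul_of_contractLeft hS _ _ (hX hy), hsu]
    ring
  · rw [add_mul, mul_add, map_add, one_mul, mul_assoc _ _ y, wick_ι_mul, hX hy, map_zero, zero_add,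
      hcomm, (commute_ι_mul_ι u w y).eq, ← mul_assoc, ← (commute_ι_mul_ι u w _).eq,
      neg_mul, map_neg]
    have h : ι R u * ι R w * (ι R s * (List.ofFn fun i => ι R (v i)).prod * y) =
        ι R s * ι R u * (ι R w * (List.ofFn fun i => ι R (v i)).prod * y) := by
      rw [mul_assoc (ι R s), ← mul_assoc _ (ι R s), (commute_ι_mul_ι u w _).eq]
      simp only [mul_assoc]
    rw [h, wick_ι_mul_ι_mul_of_contractLeft hS, hsu, neg_one_mul]
    rw [mul_assoc]
    exact contractLeft_ι_mul_eq_zero hsw (hX hy)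

end WickPfaffian

/-! ### The array of coefficients as products of row weights -/

section Beta

variable {R : Type*} [CommRing R] (a b c d z : R)

theorem beta_of_lt {k l : ℕ} (h : k < l) :
    beta a b c d z k l = rowWeight c d z k * rowWeight a b z l := by
  have hl : l ≠ 0 := by omega
  have h1 : (k : ℤ) ≠ -1 := by omega
  rw [beta, if_pos (by exact_mod_cast h), betaUpper, if_neg h1, rowWeight, rowWeight, if_neg hl]
  by_cases hk : k = 0
  · simp [hk]
  · simp only [Nat.cast_eq_zero, hk, if_false, Int.toNat_natCast]
    ring

theorem beta_swap (i j : ℤ) : beta a b c d z i j = -beta a b c d z j i := by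
  unfold beta
  split_ifs <;> first | omega | simp

theorem beta_self (i : ℤ) : beta a b c d z i i = 0 := by
  simp [beta]

theorem beta_neg_one (k : ℕ) : beta a b c d z (-1) k = rowWeight a b z k := by
  rw [beta, if_pos (by omega), betaUpper, if_pos rfl, rowWeight]
  simp

/-- Grouping the terms by the larger of the two indices gives the shape in which `pertForm_apply`
presents the perturbation. -/
theorem sum_beta_mul (f g : ℕ → R) (M : ℕ) :
    ∑ k ∈ Finset.range M, ∑ l ∈ Finset.range M, beta a b c d z k l * f l * g k =
      ∑ j ∈ Finset.range M, rowWeight a b z j *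
        (f j * ∑ i ∈ Finset.range j, rowWeight c d z i * g i -
          (∑ i ∈ Finset.range j, rowWeight c d z i * f i) * g j) := by
  induction M with
  | zero => simp
  | succ M ih =>
    simp only [Finset.sum_range_succ, Finset.sum_add_distrib, ih]
    have h1 : ∑ k ∈ Finset.range M, beta a b c d z k M * f M * g k =
        rowWeight a b z M * (f M * ∑ i ∈ Finset.range M, rowWeight c d z i * g i) := by
      rw [Finset.mul_sum, Finset.mul_sum]
      refine Finset.sum_congr rfl fun k hk => ?_
      rw [beta_of_lt a b c d z (Finset.mem_range.1 hk)]
      ring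
    have h2 : ∑ l ∈ Finset.range M, beta a b c d z M l * f l * g M =
        -(rowWeight a b z M * ((∑ i ∈ Finset.range M, rowWeight c d z i * f i) * g M)) := by
      rw [Finset.sum_mul, Finset.mul_sum, ← Finset.sum_neg_distrib]
      refine Finset.sum_congr rfl fun l hl => ?_
      rw [beta_swap, beta_of_lt a b c d z (Finset.mem_range.1 hl)]
      ring
    rw [beta_self, h1, h2]
    ring

end Beta

open ExteriorAlgebra (ι)
open CliffordAlgebra (contractLeft)

/-! ### Forms given by their values on a basis -/

section BasisForm

variable {R I : Type*} [CommRing R]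

/-- The bilinear form on the free module on `I` with the given values on the basis. -/
noncomputable def basisForm (s : I → I → R) : LinearMap.BilinForm R (I →₀ R) :=
  Finsupp.linearCombination R fun i => Finsupp.linearCombination R (s i)

theorem basisForm_single (s : I → I → R) (i j : I) :
    basisForm s (Finsupp.single i 1) (Finsupp.single j 1) = s i j := by
  simp [basisForm]

theorem basisForm_isAlt {s : I → I → R} (hs : ∀ i, s i i = 0) (hs' : ∀ i j, s i j = -s j i) :
    (basisForm s).IsAlt := by
  have hneg : ∀ v w, basisForm s v w = -basisForm s w v := by
    have : basisForm s = -(basisForm s).flip := by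
      ext i j
      simpa [basisForm] using hs' i j
    intro v w
    conv_lhs => rw [this]
    simp
  intro v
  induction v using Finsupp.induction_linear with
  | zero => simp
  | add v w hv hw => simp [hv, hw, hneg w v]
  | single i r => simp [basisForm, hs]

end BasisForm

section MatJ

variable {R : Type*} [CommRing R]

theorem mul_matJ_apply {m n : ℕ} (M : Matrix (Fin m) (Fin n) R) (i : Fin m) (j : Fin n) :
    (M * matJ R n) i j = M i j.rev := by
  rw [Matrix.mul_apply, Finset.sum_eq_single j.rev]
  · simp [matJ]
  · intro k _ hk
    have : j ≠ k.rev := fun h => hk (by rw [h, Fin.rev_rev])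
    simp [matJ, this]
  · simp

theorem matJ_mul_apply {m n : ℕ} (M : Matrix (Fin m) (Fin n) R) (i : Fin m) (j : Fin n) :
    (matJ R m * M) i j = M i.rev j := by
  rw [Matrix.mul_apply, Finset.sum_eq_single i.rev]
  · simp [matJ]
  · intro k _ hk
    simp [matJ, hk]
  · simp

end MatJ

/-! ### The sum over partitions as the Pfaffian of `D` -/

section Zeta

variable {K : Type*} [Field K]

theorem div_add_swap (s t : K) : (s - t) / (s + t) = -((t - s) / (t + s)) := by
  rw [← neg_div, neg_sub, add_comm]

variable {V : Type*} [AddCommGroup V] [Module K V] {S : LinearMap.BilinForm K V}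

/-- The parts enter in increasing order because of the factor `J_l` in `A_μ`. -/
theorem pf_matAmu_eq_wick (hS : S.IsAlt) {m : ℕ} (x : Fin m → K) (v : Fin m → V) (e : ℕ → V)
    (hv : ∀ i j, S (v i) (v j) = (x i - x j) / (x i + x j)) (he : ∀ k l, S (e k) (e l) = 0)
    (μ : List ℕ) (hve : ∀ i, ∀ k ∈ μ, S (v i) (e k) = x i ^ k) :
    pf (matAmu x μ) = wick S hS
      ((List.ofFn fun i => ι K (v i)).prod * (μ.reverse.map fun k => ι K (e k)).prod) := by
  rw [map_reverse_eq_ofFn, ofFn_prod_mul_ofFn_prod v fun j : Fin μ.length => e (μ.get j.rev),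
    wick_ofFn_prod]
  congr 1
  ext i j
  have hve' : ∀ i (j : ℕ) (hj : j < μ.length), S (v i) (e μ[j]) = x i ^ μ[j] :=
    fun i j hj => hve i _ (List.getElem_mem hj)
  have hev' : ∀ i (j : ℕ) (hj : j < μ.length), S (e μ[j]) (v i) = -x i ^ μ[j] :=
    fun i j hj => by rw [← hS.neg_eq, hve']
  refine Fin.addCases (fun i => ?_) (fun i => ?_) i <;>
    refine Fin.addCases (fun j => ?_) (fun j => ?_) j <;>
    simp [matAmu, blocks, hv, he, hve', hev', matA, mul_matJ_apply, matJ_mul_apply, matGamma]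

/-- The indices of a free module carrying a form that encodes all the matrices `A_μ`. -/
inductive ZetaIndex (n : ℕ)
  | var (i : Fin n)
  | pow (k : ℕ)
  | star
  | base

/-- The values of the form that encodes all the matrices `A_μ`. -/
def zetaEntry {n : ℕ} (x : Fin n → K) : ZetaIndex n → ZetaIndex n → K
  | .var i, .var j => (x i - x j) / (x i + x j)
  | .var i, .pow k => x i ^ k
  | .pow k, .var i => -x i ^ k
  | .star, .base => -1
  | .base, .star => 1
  | _, _ => 0

/-- The form that encodes all the matrices `A_μ`. -/
noncomputable def zetaForm {n : ℕ} (x : Fin n → K) : LinearMap.BilinForm K (ZetaIndex n →₀ K) :=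
  basisForm (zetaEntry x)

theorem zetaForm_isAlt {n : ℕ} (x : Fin n → K) : (zetaForm x).IsAlt := by
  refine basisForm_isAlt (fun i => ?_) fun i j => ?_
  · cases i <;> simp [zetaEntry]
  · cases i <;> cases j <;> simp [zetaEntry, ← div_add_swap]

theorem zetaForm_single {n : ℕ} (x : Fin n → K) (i j : ZetaIndex n) :
    zetaForm x (Finsupp.single i 1) (Finsupp.single j 1) = zetaEntry x i j :=
  basisForm_single _ _ _

theorem zetaN_eq_div (a b c d z : K) {n : ℕ} (x : Fin n → K) (N : ℕ) :
    zetaN a b c d z x N =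
      (∑ μ ∈ strictPartitions N, weight a b c d μ * z ^ μ.length * pfMu x μ) / pfMu x [] := by
  simp only [zetaN, schurP, Finset.sum_div, mul_div_assoc]

theorem pf_matAmu_eq_wick_zetaForm {n : ℕ} (x : Fin n → K) (μ : List ℕ) :
    pf (matAmu x μ) = wick (zetaForm x) (zetaForm_isAlt x)
      ((List.ofFn fun i => ι K (Finsupp.single (ZetaIndex.var i) (1 : K))).prod *
        (μ.reverse.map fun k => ι K (Finsupp.single (ZetaIndex.pow (n := n) k) (1 : K))).prod) := by
  refine pf_matAmu_eq_wick _ x (fun i => Finsupp.single (ZetaIndex.var i) (1 : K))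
    (fun k => Finsupp.single (ZetaIndex.pow k) (1 : K)) ?_ ?_ μ ?_ <;>
  simp [zetaForm_single, zetaEntry]

/-- The vector of exponent `0` plays the additional variable `0`: `(x_i - 0) / (x_i + 0) = 1 = x_i ^
0` as `x_i ≠ 0`, and `0 ^ k = 0` as all parts are positive. -/
theorem pf_matAmu_snoc_eq_wick_zetaForm {n : ℕ} (x : Fin n → K) (hx : ∀ i, x i ≠ 0) (μ : List ℕ)
    (hμ : ∀ k ∈ μ, 1 ≤ k) :
    pf (matAmu (Fin.snoc x 0 : Fin (n + 1) → K) μ) = wick (zetaForm x) (zetaForm_isAlt x)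
      ((List.ofFn fun i => ι K (Finsupp.single (ZetaIndex.var i) (1 : K))).prod *
        ι K (Finsupp.single (ZetaIndex.pow 0) 1) *
        (μ.reverse.map fun k => ι K (Finsupp.single (ZetaIndex.pow (n := n) k) (1 : K))).prod) := by
  rw [← ofFn_snoc_prod (fun i : Fin n => Finsupp.single (ZetaIndex.var i) (1 : K))]
  refine pf_matAmu_eq_wick _ _ _ (fun k => Finsupp.single (ZetaIndex.pow k) (1 : K)) ?_ ?_ μ ?_
  · intro i j
    refine Fin.lastCases ?_ (fun i => ?_) i <;> refine Fin.lastCases ?_ (fun j => ?_) j <;>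
      simp [zetaForm_single, zetaEntry, hx]
  · simp [zetaForm_single, zetaEntry]
  · intro i k hk
    have : k ≠ 0 := by have := hμ k hk; omega
    refine Fin.lastCases ?_ (fun i => ?_) i <;> simp [zetaForm_single, zetaEntry, this]

/-- Common frame for both parities of `n`. Of `p` and `q`, the one met when `n + ℓ(μ)` is even must
act as `1`, the other as the vector of the variable `0`. -/
theorem sum_pfMu_eq_wick (a b c d z : K) {n : ℕ} (x : Fin n → K) (hx : ∀ i, x i ≠ 0) (N : ℕ)
    (Y p q : ExteriorAlgebra K (ZetaIndex n →₀ K))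
    (h : ∀ y : ExteriorAlgebra K (ZetaIndex n →₀ K),
      contractLeft (zetaForm x (Finsupp.single ZetaIndex.star 1)) y = 0 →
      wick (zetaForm x) (zetaForm_isAlt x) (Y * ((if Even n then p else q) * y)) =
        wick (zetaForm x) (zetaForm_isAlt x)
          ((List.ofFn fun i => ι K (Finsupp.single (ZetaIndex.var i) (1 : K))).prod * y) ∧
      wick (zetaForm x) (zetaForm_isAlt x) (Y * ((if Even n then q else p) * y)) =
        wick (zetaForm x) (zetaForm_isAlt x)
          ((List.ofFn fun i => ι K (Finsupp.single (ZetaIndex.var i) (1 : K))).prod *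
            ι K (Finsupp.single (ZetaIndex.pow 0) 1) * y)) :
    ∑ μ ∈ strictPartitions N, weight a b c d μ * z ^ μ.length * pfMu x μ =
      wick (zetaForm x) (zetaForm_isAlt x)
        (Y * partSum a b c d z (fun k => Finsupp.single (ZetaIndex.pow k) 1) p q N) := by
  rw [partSum, Finset.mul_sum, map_sum]
  refine Finset.sum_congr rfl fun μ hμ => ?_
  rw [mul_smul_comm, map_smul, smul_eq_mul]
  congr 1
  have hμ' : ∀ k ∈ μ, 1 ≤ k := fun k hk => ((mem_strictPartitions.1 hμ).2 k hk).1
  have hc : contractLeft (zetaForm x (Finsupp.single ZetaIndex.star 1))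
      (μ.reverse.map fun k => ι K (Finsupp.single (ZetaIndex.pow (n := n) k) (1 : K))).prod = 0 := by
    have := contractLeft_prod_mul_eq_zero
      (d := zetaForm x (Finsupp.single (ZetaIndex.star (n := n)) 1)) (y := 1)
      (μ.reverse.map fun k => Finsupp.single (ZetaIndex.pow (n := n) k) (1 : K))
      (fun v hv => by
        obtain ⟨k, -, rfl⟩ := List.mem_map.1 hv
        simp [zetaForm_single, zetaEntry])
      (CliffordAlgebra.contractLeft_one _ _)
    rwa [mul_one, List.map_map] at this
  obtain ⟨h1, h2⟩ := h _ hc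
  by_cases hn : Even n <;> by_cases hl : Even μ.length <;>
    simp only [pfMu, Nat.even_add, hn, hl, if_true, if_false, iff_true, iff_false,
      not_true] at h1 h2 ⊢
  · rw [pf_matAmu_eq_wick_zetaForm, h1]
  · rw [pf_matAmu_snoc_eq_wick_zetaForm x hx μ hμ', h2]
  · rw [pf_matAmu_snoc_eq_wick_zetaForm x hx μ hμ', h2]
  · rw [pf_matAmu_eq_wick_zetaForm, h1]

theorem sum_pfMu_eq_pf_matDEven (a b c d z : K) {n : ℕ} (hn : Even n) (x : Fin n → K)
    (hx : ∀ i, x i ≠ 0) (N : ℕ) :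
    ∑ μ ∈ strictPartitions N, weight a b c d μ * z ^ μ.length * pfMu x μ =
      pf (matDEven a b c d z x N) := by
  -- With `u = 0` the prefixes reduce to `p = 1` and `q = e_0`, as needed for even `n`.
  rw [sum_pfMu_eq_wick a b c d z x hx N
    (List.ofFn fun i => ι K (Finsupp.single (ZetaIndex.var i) (1 : K))).prod
    (1 + ι K 0 * ι K (Finsupp.single (ZetaIndex.pow 0) 1))
    (ι K 0 + ι K (Finsupp.single (ZetaIndex.pow 0) 1))
    fun y _ => by simp [hn, mul_assoc],
    wick_mul_partSum (u := (0 : ZetaIndex n →₀ K)) (zetaForm_isAlt x)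
      (fun i j => by simp [zetaForm_single, zetaEntry]) (fun i => by simp), wick_ofFn_prod]
  congr 1
  ext i j
  simp only [Matrix.of_apply, matDEven, pertForm_apply, baseVec_left, zetaForm_single, zetaEntry,
    sum_beta_mul, map_zero, LinearMap.zero_apply, zero_add]
  congr 1
  refine Finset.sum_congr rfl fun k _ => ?_
  simp only [mul_neg, Finset.sum_neg_distrib]
  ring

theorem sum_pfMu_eq_pf_matDOdd (a b c d z : K) {n : ℕ} (hn : Odd n) (x : Fin n → K)
    (hx : ∀ i, x i ≠ 0) (N : ℕ) :
    ∑ μ ∈ strictPartitions N, weight a b c d μ * z ^ μ.length * pfMu x μ =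
      pf (matDOdd a b c d z x N) := by
  -- The leading vector `star` detects `base`, so that `base + e_0` acts as `1` and `1 + base * e_0`
  -- acts as `e_0`; it becomes index `0` of the bordered matrix.
  rw [sum_pfMu_eq_wick a b c d z x hx N
    (ι K (Finsupp.single ZetaIndex.star 1) *
      (List.ofFn fun i => ι K (Finsupp.single (ZetaIndex.var i) (1 : K))).prod)
    (1 + ι K (Finsupp.single ZetaIndex.base 1) * ι K (Finsupp.single (ZetaIndex.pow 0) 1))
    (ι K (Finsupp.single ZetaIndex.base 1) + ι K (Finsupp.single (ZetaIndex.pow 0) 1))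
    fun y hy => by
      rw [if_neg (Nat.not_even_iff_odd.2 hn), if_neg (Nat.not_even_iff_odd.2 hn)]
      exact wick_ι_mul_prod_mul _ (by simp [zetaForm_single, zetaEntry])
        (by simp [zetaForm_single, zetaEntry]) hn _ (by simp [zetaForm_single, zetaEntry]) hy,
    wick_mul_partSum (zetaForm_isAlt x)
      (fun i j => by simp [zetaForm_single, zetaEntry])
      (fun i => by simp [zetaForm_single, zetaEntry])]
  have h1 : ι K (Finsupp.single (ZetaIndex.star (n := n)) (1 : K)) =
      (List.ofFn fun _ : Fin 1 => ι K (Finsupp.single (ZetaIndex.star (n := n)) (1 : K))).prod := by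
    simp
  rw [h1, ofFn_prod_mul_ofFn_prod (fun _ => Finsupp.single (ZetaIndex.star (n := n)) (1 : K))
    fun i => Finsupp.single (ZetaIndex.var i) (1 : K), wick_ofFn_prod]
  congr 1
  ext i j
  refine Fin.addCases (fun i => ?_) (fun i => ?_) i <;>
    refine Fin.addCases (fun j => ?_) (fun j => ?_) j
  · simp [matDOdd, blocks, pertForm_apply, baseVec_left, zetaForm_single, zetaEntry]
  · simp [matDOdd, blocks, pertForm_apply, baseVec_left, zetaForm_single, zetaEntry, beta_neg_one]
  · simp [matDOdd, blocks, pertForm_apply, baseVec_left, zetaForm_single, zetaEntry,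
      beta_swap a b c d z _ (-1), beta_neg_one]
  · simp only [Matrix.of_apply, matDOdd, blocks, Matrix.reindex_apply, Matrix.submatrix_apply,
      finSumFinEquiv_symm_apply_natAdd, Matrix.fromBlocks_apply₂₂, Fin.append_right,
      matDEven, pertForm_apply, baseVec_left, zetaForm_single, zetaEntry,
      sum_beta_mul, zero_add]
    congr 1
    refine Finset.sum_congr rfl fun k _ => ?_
    simp only [mul_neg, Finset.sum_neg_distrib]
    ring

end Zeta

/-! ### Reversal, column operations and cancellation in the exterior algebra -/

section Elimination

variable {R V : Type*} [CommRing R] [AddCommGroup V] [Module R V]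
variable {S : LinearMap.BilinForm R V}

theorem ofFn_rev_prod {n : ℕ} (v : Fin n → V) :
    (List.ofFn fun i : Fin n => ι R (v i.rev)).prod =
      (-1) ^ (∑ i ∈ Finset.range n, i) * (List.ofFn fun i => ι R (v i)).prod := by
  induction n with
  | zero => simp
  | succ n ih =>
    rw [List.ofFn_succ']
    simp only [List.concat_eq_append, List.prod_append, List.prod_singleton, Fin.rev_castSucc,
      Fin.rev_last]
    rw [ih fun i => v i.succ, mul_assoc, ofFn_prod_mul_ι, List.ofFn_succ, List.prod_cons,
      Finset.sum_range_succ, pow_add, mul_assoc]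

/-- For `n = 2m` the exponent is `m(2m - 1)`, which has the parity of `m`. -/
theorem neg_one_pow_sum_range {n : ℕ} (hn : Even n) :
    (-1 : R) ^ (∑ i ∈ Finset.range n, i) = (-1) ^ (n / 2) := by
  obtain ⟨m, rfl⟩ := hn
  rw [Finset.sum_range_id, ← two_mul, Nat.mul_div_cancel_left _ two_pos, mul_assoc,
    Nat.mul_div_cancel_left _ two_pos]
  rcases m with _ | m
  · simp
  · have : (m + 1) * (2 * (m + 1) - 1) = (m + 1) + 2 * ((m + 1) * m) := by
      rw [show 2 * (m + 1) - 1 = 2 * m + 1 by omega]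
      ring
    rw [this, pow_add, pow_mul, neg_one_sq, one_pow, mul_one]

/-- Reversing the order of the vectors and changing the sign of the form preserves the Pfaffian. -/
theorem wick_ofFn_rev_prod (hS : S.IsAlt) {n : ℕ} (hn : Even n) (v : Fin n → V) :
    wick S hS (List.ofFn fun i : Fin n => ι R (v i.rev)).prod =
      pf (-Matrix.of fun i j => S (v i) (v j)) := by
  have h : ((-1) ^ (∑ i ∈ Finset.range n, i) : ExteriorAlgebra R V) =
      algebraMap R _ ((-1) ^ (∑ i ∈ Finset.range n, i)) := by simp
  rw [ofFn_rev_prod, pf_neg, h, ← Algebra.smul_def, map_smul, wick_ofFn_prod, smul_eq_mul,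
    neg_one_pow_sum_range hn]

/-- Each correction `w i` can be moved, up to sign, to the right until it meets `Q` and dies. This
is the exterior algebra form of adding multiples of some rows and columns to others. -/
theorem ofFn_add_prod_mul {n : ℕ} (v w : Fin n → V) {Q : ExteriorAlgebra R V}
    (hQ : ∀ i, ι R (w i) * Q = 0) :
    (List.ofFn fun i => ι R (v i + w i)).prod * Q = (List.ofFn fun i => ι R (v i)).prod * Q := by
  induction n with
  | zero => simp
  | succ n ih =>
    rw [List.ofFn_succ, List.prod_cons, mul_assoc, ih _ _ fun i => hQ i.succ, map_add, add_mul,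
      List.ofFn_succ (f := fun i => ι R (v i)), List.prod_cons, mul_assoc, add_eq_left]
    have h := ofFn_prod_mul_ι (R := R) (fun i => v (Fin.succ i)) (w 0)
    have h' : ι R (w 0) * (List.ofFn fun i => ι R (v (Fin.succ i))).prod =
        (-1) ^ n * ((List.ofFn fun i => ι R (v (Fin.succ i))).prod * ι R (w 0)) := by
      rw [h, ← mul_assoc, ← pow_add, ← two_mul, pow_mul, neg_one_sq, one_pow, one_mul]
    rw [← mul_assoc, h', mul_assoc, mul_assoc, hQ, mul_zero, mul_zero]

theorem ι_mul_ofFn_prod_eq_zero {n : ℕ} (v : Fin n → V) (i : Fin n) :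
    ι R (v i) * (List.ofFn fun j => ι R (v j)).prod = 0 :=
  ExteriorAlgebra.ι_mul_prod_list v i

theorem ι_mul_ofFn_prod_of_mem_span {n : ℕ} (v : Fin n → V) {w : V}
    (hw : w ∈ Submodule.span R (Set.range v)) :
    ι R w * (List.ofFn fun j => ι R (v j)).prod = 0 := by
  induction hw using Submodule.span_induction with
  | mem w hw =>
    obtain ⟨i, rfl⟩ := hw
    exact ι_mul_ofFn_prod_eq_zero v i
  | zero => simp
  | add v w _ _ hv hw => rw [map_add, add_mul, hv, hw, add_zero]
  | smul r v _ hv => rw [map_smul, smul_mul_assoc, hv, smul_zero]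

theorem contractLeft_ofFn_prod_mul_eq_zero {d : Module.Dual R V} {n : ℕ} (v : Fin n → V)
    {y : ExteriorAlgebra R V} (hv : ∀ i, d (v i) = 0) (hy : contractLeft d y = 0) :
    contractLeft d ((List.ofFn fun i => ι R (v i)).prod * y) = 0 := by
  have := contractLeft_prod_mul_eq_zero (d := d) (List.ofFn v)
    (fun v hv' => by obtain ⟨i, rfl⟩ := (List.mem_ofFn' _ _).1 hv'; exact hv i) hy
  rwa [List.map_ofFn] at this

/-- Dual families of vectors surrounding a product cancel, if one of them pairs only with the
other. -/
theorem wick_surround (hS : S.IsAlt) (e f : ℕ → V) (he : ∀ i j, S (e i) (e j) = 0)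
    (hef : ∀ i j, S (e i) (f j) = if i = j then 1 else 0) {Y : ExteriorAlgebra R V}
    (hY : ∀ w, Commute Y (ι R w)) (N : ℕ)
    (hY' : ∀ i < N, contractLeft (S (e i)) Y = 0) :
    wick S hS ((List.ofFn fun i : Fin N => ι R (e i.rev)).prod * (Y *
      (List.ofFn fun i : Fin N => ι R (f i)).prod)) = wick S hS Y := by
  induction N with
  | zero => simp
  | succ N ih =>
    have h1 : (List.ofFn fun i : Fin (N + 1) => ι R (e i.rev)).prod =
        ι R (e N) * (List.ofFn fun i : Fin N => ι R (e i.rev)).prod := by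
      simp [List.ofFn_succ]
    have h2 : (List.ofFn fun i : Fin (N + 1) => ι R (f i)).prod =
        (List.ofFn fun i : Fin N => ι R (f i)).prod * ι R (f N) := by
      rw [List.ofFn_succ']
      simp
    rw [h1, h2]
    set P := (List.ofFn fun i : Fin N => ι R (e i.rev)).prod with hP
    set Q := (List.ofFn fun i : Fin N => ι R (f i)).prod with hQ
    have hQf : ∀ w, Q * ι R w = (-1) ^ N * (ι R w * Q) := fun w => ofFn_prod_mul_ι _ _
    have hPf : ∀ w, P * ι R w = (-1) ^ N * (ι R w * P) := fun w => ofFn_prod_mul_ι _ _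
    have hc : ∀ y : ExteriorAlgebra R V, y * (-1) ^ N = (-1) ^ N * y := fun y =>
      ((Commute.neg_one_right y).pow_right N).eq
    -- Moving `f N` left costs `(-1) ^ N` at `Q`, nothing at `Y`, and `(-1) ^ N` again at `P`.
    have h3 : ι R (e N) * P * (Y * (Q * ι R (f N))) = ι R (e N) * ι R (f N) * (P * (Y * Q)) := by
      have h4 : P * (Y * (Q * ι R (f N))) = (-1) ^ N * (P * ι R (f N) * (Y * Q)) := by
        rw [hQf, ← mul_assoc Y, hc, mul_assoc ((-1) ^ N) Y, ← mul_assoc Y, (hY _).eq,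
          ← mul_assoc P, hc]
        simp only [mul_assoc]
      rw [mul_assoc, h4, hPf, mul_assoc ((-1) ^ N), ← mul_assoc ((-1) ^ N), ← pow_add, ← two_mul,
        pow_mul, neg_one_sq, one_pow, one_mul]
      simp only [mul_assoc]
    rw [h3, wick_ι_mul_ι_mul_of_contractLeft, hef, if_pos rfl, one_mul,
      ih fun i hi => hY' i (Nat.lt_succ_of_lt hi)]
    refine contractLeft_ofFn_prod_mul_eq_zero _ (fun i => he _ _) ?_
    have hYQ : Y * Q = Q * Y := by
      have : ∀ l : List V, Commute Y (l.map fun v => ι R v).prod := fun l => by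
        induction l with
        | nil => simp
        | cons v l ih => simpa using (hY v).mul_right ih
      have h := (this (List.ofFn fun i : Fin N => f i)).eq
      rwa [List.map_ofFn] at h
    rw [hYQ]
    refine contractLeft_ofFn_prod_mul_eq_zero _ (fun i => ?_) (hY' N (Nat.lt_succ_self N))
    rw [hef, if_neg (by have := i.2; omega)]

theorem commute_ofFn_prod {n : ℕ} (hn : Even n) (v : Fin n → V) (w : V) :
    Commute (List.ofFn fun i => ι R (v i)).prod (ι R w) := by
  rw [Commute, SemiconjBy, ofFn_prod_mul_ι, hn.neg_one_pow, one_mul]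

end Elimination

/-! ### The Pfaffian of `C` reduced to that of `D` -/

section MatC

variable {K : Type*} [Field K]

/-- The indices of a free module carrying a form that encodes the matrices `C_{n,N}`. -/
inductive MatCIndex (n : ℕ)
  | pow (k : ℕ)
  | var (i : Fin n)
  | dual (k : ℤ)

/-- The values of the form that encodes the matrices `C_{n,N}`. -/
def matCEntry (a b c d z : K) {n : ℕ} (x : Fin n → K) : MatCIndex n → MatCIndex n → K
  | .pow k, .var i => x i ^ k
  | .var i, .pow k => -x i ^ k
  | .var i, .var j => (x j - x i) / (x j + x i)
  | .pow k, .dual l => if (k : ℤ) = l then 1 else 0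
  | .dual l, .pow k => if (k : ℤ) = l then -1 else 0
  | .dual k, .dual l => beta a b c d z k l
  | _, _ => 0

/-- The form that encodes the matrices `C_{n,N}`. -/
noncomputable def matCForm (a b c d z : K) {n : ℕ} (x : Fin n → K) :
    LinearMap.BilinForm K (MatCIndex n →₀ K) :=
  basisForm (matCEntry a b c d z x)

variable (a b c d z : K) {n : ℕ} (x : Fin n → K) (N : ℕ)

theorem matCForm_isAlt : (matCForm a b c d z x).IsAlt := by
  refine basisForm_isAlt (fun i => ?_) fun i j => ?_
  · cases i <;> simp [matCEntry, beta_self]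
  · cases i <;> cases j <;> simp only [matCEntry, ← div_add_swap, neg_neg, neg_zero]
    · split_ifs <;> simp
    · split_ifs <;> simp
    · exact beta_swap ..

theorem matCForm_single (i j : MatCIndex n) :
    matCForm a b c d z x (Finsupp.single i 1) (Finsupp.single j 1) = matCEntry a b c d z x i j :=
  basisForm_single _ _ _

/-- The vectors of the variables, made orthogonal to those of the powers. -/
noncomputable def reducedVar (i : Fin n) : MatCIndex n →₀ K :=
  Finsupp.single (MatCIndex.var i) 1 +
    -∑ k : Fin (N + 1), x i ^ (k : ℕ) • Finsupp.single (MatCIndex.dual (k : ℕ)) 1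

theorem matCForm_pow_pow (k l : ℕ) :
    matCForm a b c d z x (Finsupp.single (.pow k) 1) (Finsupp.single (.pow l) 1) = 0 := by
  simp [matCForm_single, matCEntry]

theorem matCForm_pow_dual (k l : ℕ) :
    matCForm a b c d z x (Finsupp.single (.pow k) 1) (Finsupp.single (.dual (l : ℕ)) 1) =
      if k = l then 1 else 0 := by
  simp [matCForm_single, matCEntry]

theorem matCForm_pow_reducedVar (k : Fin (N + 1)) (i : Fin n) :
    matCForm a b c d z x (Finsupp.single (.pow k) 1) (reducedVar x N i) = 0 := by
  simp only [reducedVar, map_add, map_neg, map_sum, map_smul, matCForm_single, matCEntry]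
  simp [← Fin.ext_iff]

theorem matCForm_dual_reducedVar (k : ℤ) (i : Fin n) :
    matCForm a b c d z x (Finsupp.single (.dual k) 1) (reducedVar x N i) =
      -∑ l ∈ Finset.range (N + 1), beta a b c d z k l * x i ^ l := by
  rw [Finset.sum_range]
  simp only [reducedVar, map_add, map_neg, map_sum, map_smul, matCForm_single, matCEntry]
  simp [mul_comm]

/-- The second argument is orthogonal to the powers, and pairing it with the duals in the first
argument produces the double sum over `β`. The overall sign comes from the transposed block of `A_n`
in `C`. -/
theorem matCForm_reducedVar_reducedVar (i j : Fin n) :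
    matCForm a b c d z x (reducedVar x N i) (reducedVar x N j) =
      -matDEven a b c d z x N i j := by
  have h : matCForm a b c d z x (Finsupp.single (.var i) 1) (reducedVar x N j) =
      -((x i - x j) / (x i + x j)) := by
    simp only [reducedVar, map_add, map_neg, map_sum, map_smul, matCForm_single, matCEntry]
    simp [← div_add_swap]
  conv_lhs => arg 1; rw [reducedVar]
  rw [map_add, LinearMap.add_apply, h, matDEven, Matrix.of_apply, neg_add]
  congr 1
  rw [map_neg, LinearMap.neg_apply, map_sum, LinearMap.sum_apply]
  simp only [map_smul, LinearMap.smul_apply, matCForm_dual_reducedVar, smul_eq_mul]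
  rw [Finset.sum_comm, Finset.sum_range]
  rw [← Finset.sum_neg_distrib, ← Finset.sum_neg_distrib]
  refine Finset.sum_congr rfl fun k _ => ?_
  rw [mul_neg, neg_neg, Finset.mul_sum, ← Finset.sum_neg_distrib]
  refine Finset.sum_congr rfl fun l _ => ?_
  rw [beta_swap]
  ring

theorem ι_mul_dual_prod (i : Fin n) :
    ι K (-∑ k : Fin (N + 1), x i ^ (k : ℕ) •
        Finsupp.single (MatCIndex.dual (n := n) (k : ℕ)) (1 : K)) *
      (List.ofFn fun k : Fin (N + 1) =>
        ι K (Finsupp.single (MatCIndex.dual (n := n) (k : ℕ)) (1 : K))).prod = 0 :=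
  ι_mul_ofFn_prod_of_mem_span
    (fun k : Fin (N + 1) => Finsupp.single (MatCIndex.dual (n := n) (k : ℕ)) (1 : K))
    (neg_mem (Submodule.sum_mem _ fun k _ => Submodule.smul_mem _ _
      (Submodule.subset_span ⟨k, rfl⟩)))

theorem matJ_apply {R : Type*} [CommRing R] {m : ℕ} (i j : Fin m) :
    matJ R m i j = if (i.rev : ℕ) = j then 1 else 0 := by
  simp only [matJ, Matrix.of_apply, Fin.ext_iff, eq_comm]

theorem contractLeft_reducedVar_prod {y : ExteriorAlgebra K (MatCIndex n →₀ K)} {k : ℕ}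
    (hk : k < N + 1)
    (hy : contractLeft (matCForm a b c d z x (Finsupp.single (.pow k) 1)) y = 0) :
    contractLeft (matCForm a b c d z x (Finsupp.single (.pow k) 1))
      ((List.ofFn fun i : Fin n => ι K (reducedVar x N i.rev)).prod * y) = 0 :=
  contractLeft_ofFn_prod_mul_eq_zero _
    (fun i => matCForm_pow_reducedVar a b c d z x N ⟨k, hk⟩ i.rev) hy

/-- The variables are replaced by their reduced versions at no cost, then the powers and duals
cancel around them. What is left is the reversed Gram matrix of `-D`; the signs from reversal and
negation agree for even `n`. -/
theorem pf_matCEven (hn : Even n) : pf (matCEven a b c d z x N) = pf (matDEven a b c d z x N) := by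
  have h1 : matCEven a b c d z x N = Matrix.of fun i j => matCForm a b c d z x
      (Fin.append (Fin.append (fun k : Fin (N + 1) => Finsupp.single (.pow k.rev) 1)
        fun i : Fin n => Finsupp.single (.var i.rev) 1)
        (fun k : Fin (N + 1) => Finsupp.single (.dual (k : ℕ)) 1) i)
      (Fin.append (Fin.append (fun k : Fin (N + 1) => Finsupp.single (.pow k.rev) 1)
        fun i : Fin n => Finsupp.single (.var i.rev) 1)
        (fun k : Fin (N + 1) => Finsupp.single (.dual (k : ℕ)) 1) j) := by
    ext i j
    refine Fin.addCases (fun i => Fin.addCases (fun i => ?_) (fun i => ?_) i) (fun i => ?_) i <;>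
      refine Fin.addCases (fun j => Fin.addCases (fun j => ?_) (fun j => ?_) j) (fun j => ?_) j <;>
      simp [matCEven, blocks₃, matCForm_single, matCEntry, mul_matJ_apply, matJ_mul_apply,
        matJ_apply, matGamma, muTop, matA, matB]
    split_ifs <;> first | omega | simp
  rw [h1, ← wick_ofFn_prod (matCForm_isAlt a b c d z x), ← ofFn_prod_mul_ofFn_prod,
    ← ofFn_prod_mul_ofFn_prod, mul_assoc, ← ofFn_add_prod_mul _ _
      fun i : Fin n => ι_mul_dual_prod x N i.rev]
  change wick _ _ (_ * ((List.ofFn fun i : Fin n => ι K (reducedVar x N i.rev)).prod * _)) = _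
  rw [wick_surround (matCForm_isAlt a b c d z x) (fun k => Finsupp.single (.pow k) 1)
      (fun k => Finsupp.single (.dual (k : ℕ)) 1) (matCForm_pow_pow a b c d z x)
      (matCForm_pow_dual a b c d z x) (commute_ofFn_prod hn _) _ fun k hk => ?_,
    wick_ofFn_rev_prod _ hn]
  · congr 1
    ext i j
    simp [matCForm_reducedVar_reducedVar]
  · have := contractLeft_reducedVar_prod a b c d z x N hk (CliffordAlgebra.contractLeft_one _ _)
    rwa [mul_one] at this

/-- As in the even case, except that the dual vector of index `-1` pairs with no power and so
survives the cancellation. It joins the variables, and the family left has even size `1 + n`. -/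
theorem pf_matCOdd (hn : Odd n) : pf (matCOdd a b c d z x N) = pf (matDOdd a b c d z x N) := by
  have h1 : matCOdd a b c d z x N = Matrix.of fun i j => matCForm a b c d z x
      (Fin.append (Fin.append (fun k : Fin (N + 1) => Finsupp.single (.pow k.rev) 1)
        fun i : Fin n => Finsupp.single (.var i.rev) 1)
        (fun k : Fin (N + 2) => Finsupp.single (.dual ((k : ℕ) - 1)) 1) i)
      (Fin.append (Fin.append (fun k : Fin (N + 1) => Finsupp.single (.pow k.rev) 1)
        fun i : Fin n => Finsupp.single (.var i.rev) 1)
        (fun k : Fin (N + 2) => Finsupp.single (.dual ((k : ℕ) - 1)) 1) j) := by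
    have hJ : ∀ (i : Fin (N + 1)) (k : Fin (N + 2)), matJ' K N i k =
        if ((i.rev : ℕ) : ℤ) = (k : ℕ) - 1 then 1 else 0 := fun i k => by
      refine Fin.cases ?_ (fun k => ?_) k
      · rw [if_neg (by simp only [Fin.val_zero]; omega)]
        simp [matJ']
      · simp only [matJ', Matrix.of_apply, Fin.cons_succ, matJ_apply, Fin.val_succ, Nat.cast_add,
          Nat.cast_one, add_sub_cancel_right, Nat.cast_inj]
    ext i j
    refine Fin.addCases (fun i => Fin.addCases (fun i => ?_) (fun i => ?_) i) (fun i => ?_) i <;>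
      refine Fin.addCases (fun j => Fin.addCases (fun j => ?_) (fun j => ?_) j) (fun j => ?_) j <;>
      simp [matCOdd, blocks₃, matCForm_single, matCEntry, mul_matJ_apply, matJ_mul_apply,
        hJ, matGamma, muTop, matA, matB']
    split_ifs <;> simp
  have h2 : (List.ofFn fun k : Fin (N + 2) =>
        ι K (Finsupp.single (MatCIndex.dual (n := n) ((k : ℕ) - 1)) (1 : K))).prod =
      ι K (Finsupp.single (.dual (-1)) 1) * (List.ofFn fun k : Fin (N + 1) =>
        ι K (Finsupp.single (MatCIndex.dual (n := n) (k : ℕ)) (1 : K))).prod := by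
    rw [List.ofFn_succ, List.prod_cons]
    simp
  -- The surviving vector stands right after the reversed variables, hence comes first once the
  -- order is restored: it gives the row and column `0` of `D`.
  have h3 : (List.ofFn fun i : Fin n => ι K (reducedVar x N i.rev)).prod *
        ι K (Finsupp.single (.dual (-1)) 1) =
      (List.ofFn fun i : Fin (1 + n) => ι K (Fin.append
        (fun _ : Fin 1 => Finsupp.single (.dual (-1)) 1) (reducedVar x N) i.rev)).prod := by
    rw [ofFn_rev_prod, ofFn_rev_prod, ← ofFn_prod_mul_ofFn_prod, mul_assoc, ofFn_prod_mul_ι,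
      ← mul_assoc, ← pow_add, ← Finset.sum_range_succ, add_comm 1 n]
    simp
  rw [h1, ← wick_ofFn_prod (matCForm_isAlt a b c d z x), ← ofFn_prod_mul_ofFn_prod,
    ← ofFn_prod_mul_ofFn_prod, mul_assoc, h2, ← ofFn_add_prod_mul _ _
      fun i : Fin n => (by
        rw [← mul_assoc, ι_mul_ι_swap, neg_mul, mul_assoc, ι_mul_dual_prod x N i.rev, mul_zero,
          neg_zero])]
  change wick _ _ (_ * ((List.ofFn fun i : Fin n => ι K (reducedVar x N i.rev)).prod * _)) = _
  rw [← mul_assoc _ (ι K _), h3]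
  have hn' : Even (1 + n) := Odd.add_odd odd_one hn
  rw [wick_surround (matCForm_isAlt a b c d z x) (fun k => Finsupp.single (.pow k) 1)
      (fun k => Finsupp.single (.dual (k : ℕ)) 1) (matCForm_pow_pow a b c d z x)
      (matCForm_pow_dual a b c d z x) (commute_ofFn_prod hn' _) _ fun k hk => ?_,
    wick_ofFn_rev_prod _ hn']
  · congr 1
    ext i j
    refine Fin.addCases (fun i => ?_) (fun i => ?_) i <;>
      refine Fin.addCases (fun j => ?_) (fun j => ?_) j
    · simp [matDOdd, blocks, matCForm_single, matCEntry, beta_self]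
    · simp [matDOdd, blocks, matCForm_dual_reducedVar]
    · simp only [Matrix.neg_apply, Matrix.of_apply, Fin.append_left, Fin.append_right]
      rw [(matCForm_isAlt a b c d z x).neg_eq, matCForm_dual_reducedVar]
      simp [matDOdd, blocks, beta_swap a b c d z _ (-1)]
    · simp [matDOdd, blocks, matCForm_reducedVar_reducedVar]
  · rw [← h3]
    refine contractLeft_reducedVar_prod a b c d z x N hk ?_
    have := contractLeft_ι_mul_eq_zero
      (d := matCForm a b c d z x (Finsupp.single (.pow k) 1))
      (v := Finsupp.single (.dual (-1)) 1) (y := 1)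
      (by simp only [matCForm_single, matCEntry]; rw [if_neg (by omega)])
      (CliffordAlgebra.contractLeft_one _ _)
    rwa [mul_one] at this

end MatC

end SchurPSum

theorem mainTheorem11 {K : Type*} [Field K] (a b c d z : K) (n N : ℕ) (hN : N ≤ n)
    (x : Fin n → K) (hx : ∀ i, x i ≠ 0)
    (hne : ∀ i j, i ≠ j → x i ≠ x j) (hadd : ∀ i j, i ≠ j → x i + x j ≠ 0) :
    (Even n →
      SchurPSum.zetaN a b c d z x N =
          SchurPSum.pf (SchurPSum.matCEven a b c d z x N) / SchurPSum.pfMu x [] ∧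
      SchurPSum.zetaN a b c d z x N =
          SchurPSum.pf (SchurPSum.matDEven a b c d z x N) / SchurPSum.pfMu x []) ∧
    (Odd n →
      SchurPSum.zetaN a b c d z x N =
          SchurPSum.pf (SchurPSum.matCOdd a b c d z x N) / SchurPSum.pfMu x [] ∧
      SchurPSum.zetaN a b c d z x N =
          SchurPSum.pf (SchurPSum.matDOdd a b c d z x N) / SchurPSum.pfMu x []) := by
  rw [SchurPSum.zetaN_eq_div]
  refine ⟨fun hn => ?_, fun hn => ?_⟩
  · rw [SchurPSum.pf_matCEven a b c d z x N hn,
      SchurPSum.sum_pfMu_eq_pf_matDEven a b c d z hn x hx N]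
    exact ⟨rfl, rfl⟩
  · rw [SchurPSum.pf_matCOdd a b c d z x N hn,
      SchurPSum.sum_pfMu_eq_pf_matDOdd a b c d z hn x hx N]
    exact ⟨rfl, rfl⟩
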